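/- **Conventions.** A generalized quantum circuit is a circuit over the gate set $\{CNOT,H,T\}$ some of whose wires are initialized to $|0\rangle$ and some of whose wires are traced out at the end; its size is the number of gates plus the numbers of input and output qubits (counting the initialized and the traced-out ones). A QPT algorithm is a family $\{A_\lambda\}_{\lambda\in\mathbb N}$ of generalized circuits of size polynomial in $\lambda$; it is uniform if a deterministic polynomial-time Turing machine outputs the description of $A_\lambda$ on input $1^\lambda$; a non-uniform QPT algorithm additionally gets an arbitrary advice state $\rho_\lambda$ as part of its input. A function $\varepsilon$ is negligible if $\lambda^d\varepsilon(\lambda)\to 0$ for every $d\in\mathbb N$. **Strong QPRG.** A strong quantum pseudorandom generator (sQPRG) with output length $\ell$ is a uniform QPT algorithm $G$ which maps a seed $k\in\{0,1\}^\lambda$ to a random string $G_\lambda(k)\in\{0,1\}^{\ell(\lambda)}$ (obtained by measurement), such that: (i) there are $c>0$ and $\mu(\lambda)=O(\lambda^{-c})$ such that for every $\lambda$ there is $\mathcal K_\lambda\subseteq\{0,1\}^\lambda$ with $|\mathcal K_\lambda|/2^\lambda\ge 1-\mu(\lambda)$ and $\max_y\Pr[G_\lambda(k)=y]\ge 1-\mu(\lambda)$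 for all $k\in\mathcal K_\lambda$; (ii) $\ell(\lambda)>\lambda$ for all $\lambda\ge 1$; (iii) for every non-uniform QPT algorithm $A$ with one output bit, $\bigl|\Pr_{k\gets\{0,1\}^\lambda}[A_\lambda(G_\lambda(k))=1]-\Pr_{y\gets\{0,1\}^{\ell(\lambda)}}[A_\lambda(y)=1]\bigr|$ is negligible. **Construction.** Let $G$ be an sQPRG with output length $3\lambda$. *Commit phase:* the receiver sends a uniform $r\in\{0,1\}^{3\lambda}$; to commit to $b\in\{0,1\}$ the committer samples uniform independent $k_1,\dots,k_\lambda\in\{0,1\}^\lambda$ and sends $\mathsf{Com}=G(k_1)\|\cdots\|G(k_\lambda)$ if $b=0$ and $\mathsf{Com}=(G(k_1)\oplus r)\|\cdots\|(G(k_\lambda)\oplus r)$ if $b=1$. *Reveal phase:* the committer sends $(b,k_1,\dots,k_\lambda)$; the receiver writes $\mathsf{Com}=y_1\|\cdots\|y_\lambda$, runs $G$ afresh on every $k_i$, counts the number $N$ of indices $i$ with $y_i=G(k_i)$ (if $b=0$), respectively $y_i=G(k_i)\oplus r$ (if $b=1$), and outputs $b$ if $N\ge 2\lambda/3$ and $\bot$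 otherwise. All messages are classical. **Theorem.** For every sQPRG $G$ with output length $3\lambda$ the following holds. 1. *Efficiency.* The number of elementary steps of the honest committer and receiver is at most polynomial in $\lambda$, where sampling, XORing, comparing or counting $m$ bits costs $m$ steps, running $G_\lambda$ costs as many steps as the size of its circuit, and each loop iteration costs one step. 2. *Correctness.* There is a negligible $\varepsilon$ such that for all $\lambda$ and $b\in\{0,1\}$, the receiver outputs $b$ with probability at least $1-\varepsilon(\lambda)$ when the honest parties carry out both phases on the bit $b$. 3. *Computational hiding.* For every malicious non-uniform QPT receiver $R^*$ (which prepares a state, measures part of it to obtain the message $r$, and ends the commit phase with the state $\sigma_{R^*}$ consisting of $\mathsf{Com}$ and its remaining qubits) and every non-uniform QPT distinguisher $D$, the difference $\bigl|\Pr[D_\lambda(\sigma_{R^*})=1\mid b=0]-\Pr[D_\lambda(\sigma_{R^*})=1\mid b=1]\bigr|$ is negligible. 4. *Statistical binding.* There is a negligible $\varepsilon$ such that for every $\lambda$ and every computationally unbounded malicious committer, which on receiving a uniform $r$ chooses, possibly at random, a commitment $\mathsf{Com}$ and two decommitments, the probability that two independent executions of the receiver's reveal check on $(r,\mathsf{Com})$,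 with the first and the second decommitment respectively, output $0$ and $1$ is at most $\varepsilon(\lambda)$. -/

import Mathlib

noncomputable section

namespace QCommit

open Matrix Filter
open scoped ComplexOrder

/-- Bit strings of length `n`; also the computational basis labels of `n` qubits. -/
abbrev Bits (n : ℕ) : Type := Fin n → Bool

/-- Operators on `n` qubits, written in the computational basis. -/
abbrev Op (n : ℕ) : Type := Matrix (Bits n) (Bits n) ℂ

/-- Density matrices on `n` qubits. -/
def IsDensity {n : ℕ} (ρ : Op n) : Prop := ρ.PosSemidef ∧ ρ.trace = 1

/-- The tensor product `ρ ⊗ σ`; the qubits of `ρ` come first. -/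
def tensor {m n : ℕ} (ρ : Op m) (σ : Op n) : Op (m + n) := Matrix.of fun x y =>
  ρ (fun i => x (Fin.castAdd n i)) (fun i => y (Fin.castAdd n i)) *
    σ (fun j => x (Fin.natAdd m j)) (fun j => y (Fin.natAdd m j))

/-- The classical mixed state `∑ x, μ x • |x⟩⟨x|` of a random bit string with law `μ`. -/
def classicalState {n : ℕ} (μ : PMF (Bits n)) : Op n :=
  Matrix.diagonal fun x => (((μ x).toReal : ℝ) : ℂ)

/-! ### Generalized quantum circuits over the gate set `{CNOT, H, T}` -/

/-- Elementary gates on `w` wires. -/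
inductive Gate (w : ℕ) : Type
  | H (i : Fin w) : Gate w
  | T (i : Fin w) : Gate w
  | CNOT (c t : Fin w) (h : c ≠ t) : Gate w

/-- The unitary matrix of a gate. -/
def Gate.mat {w : ℕ} : Gate w → Op w
  | .H i => Matrix.of fun x y =>
      if ∀ j, j ≠ i → x j = y j then
        (if x i && y i then -1 else 1) * (((Real.sqrt 2)⁻¹ : ℝ) : ℂ)
      else 0
  | .T i => Matrix.diagonal fun x =>
      if x i then Complex.exp ((Real.pi / 4 : ℝ) * Complex.I) else 1
  | .CNOT c t _ => Matrix.of fun x y =>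
      if x = Function.update y t (xor (y t) (y c)) then 1 else 0

/-- A generalized quantum circuit with `m` input and `n` output qubits. The wires outside the range
of `inp` start in the state `|0⟩`; the wires outside the range of `out` are traced out. -/
structure Circuit (m n : ℕ) : Type where
  wires : ℕ
  inp : Fin m ↪ Fin wires
  out : Fin n ↪ Fin wires
  gates : List (Gate wires)

namespace Circuit

variable {m n : ℕ}

/-- The number of gates plus the numbers of input and of output qubits, where the qubits that are
initialized to zero and those that are traced out are counted. -/
def size (C : Circuit m n) : ℕ := C.gates.length + C.wires + C.wires

/-- The unitary part; the head of the list of gates acts first. -/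
def unitary (C : Circuit m n) : Op C.wires := C.gates.foldl (fun U g => g.mat * U) 1

/-- The isometry `|u⟩ ↦ |u⟩ ⊗ |0⋯0⟩` that adds the qubits initialized to zero. -/
def initIso (C : Circuit m n) : Matrix (Bits C.wires) (Bits m) ℂ := Matrix.of fun x u =>
  if x = Function.extend C.inp u (fun _ => false) then 1 else 0

/-- The partial trace over the wires that are not output wires. -/
def traceOut (C : Circuit m n) (σ : Op C.wires) : Op n := Matrix.of fun u v =>
  ∑ x : Bits C.wires, ∑ y : Bits C.wires,
    if (∀ i, x (C.out i) = u i) ∧ (∀ i, y (C.out i) = v i) ∧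
        (∀ j, j ∉ Set.range C.out → x j = y j) then σ x y else 0

/-- The quantum channel of a generalized circuit. -/
def run (C : Circuit m n) (ρ : Op m) : Op n :=
  C.traceOut ((C.unitary * C.initIso) * ρ * (C.unitary * C.initIso)ᴴ)

end Circuit

theorem Gate.mat_unitary {w : ℕ} (g : Gate w) : g.matᴴ * g.mat = 1 := by
  cases g with
  | H i =>
    ext x y
    have hs : (((Real.sqrt 2)⁻¹ : ℝ) : ℂ) * (((Real.sqrt 2)⁻¹ : ℝ) : ℂ) = 1 / 2 := by
      rw [← Complex.ofReal_mul, ← mul_inv, Real.mul_self_sqrt (by norm_num)]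
      push_cast
      norm_num
    have hne : Function.update x i false ≠ Function.update x i true := fun h => by
      simpa using congrFun h i
    rw [Matrix.mul_apply, ← Finset.sum_subset
      (Finset.subset_univ {Function.update x i false, Function.update x i true}),
      Finset.sum_pair hne]
    · have key : ∀ b : Bool, (∀ j, j ≠ i → Function.update x i b j = x j) := fun b j hj => by
        simp [hj]
      have key2 : ∀ b : Bool, (∀ j, j ≠ i → Function.update x i b j = y j) ↔
          (∀ j, j ≠ i → x j = y j) := fun b =>
        forall_congr' fun j => forall_congr' fun hj => by simp [hj]
      simp only [Gate.mat, Matrix.conjTranspose_apply, Matrix.of_apply, key2, Function.update_self]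
      simp only [if_pos (key _)]
      by_cases hxy : ∀ j, j ≠ i → x j = y j
      · have hiff : x = y ↔ x i = y i := by
          refine ⟨fun h => h ▸ rfl, fun h => funext fun j => ?_⟩
          by_cases hj : j = i
          · rw [hj, h]
          · exact hxy j hj
        rw [Matrix.one_apply]
        simp only [hiff, if_pos hxy]
        have hc : (starRingEnd ℂ) (((Real.sqrt 2)⁻¹ : ℝ) : ℂ) = (((Real.sqrt 2)⁻¹ : ℝ) : ℂ) :=
          Complex.conj_ofReal _
        generalize (((Real.sqrt 2)⁻¹ : ℝ) : ℂ) = a at hs hc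
        cases x i <;> cases y i <;> simp [hc] <;> linear_combination 2 * hs
      · have hne' : x ≠ y := fun h => hxy fun j _ => by rw [h]
        simp [hxy, hne']
    · intro z _ hz
      have hzx : ¬ ∀ j, j ≠ i → z j = x j := by
        intro h
        apply hz
        have : z = Function.update x i (z i) := by
          funext j
          by_cases hj : j = i
          · subst hj
            simp
          · simp [hj, h j hj]
        rw [this]
        cases z i <;> simp
      simp only [Gate.mat, Matrix.conjTranspose_apply, Matrix.of_apply, if_neg hzx, star_zero,
        zero_mul]
  | T i =>
    simp only [Gate.mat, Matrix.diagonal_conjTranspose, Matrix.diagonal_mul_diagonal]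
    rw [← Matrix.diagonal_one]
    congr 1
    funext x
    by_cases hx : x i
    · simp only [Pi.star_apply, hx, if_true]
      rw [Complex.star_def, ← Complex.normSq_eq_conj_mul_self, Complex.normSq_eq_norm_sq,
        Complex.norm_exp_ofReal_mul_I]
      simp
    · simp [hx]
  | CNOT c t h =>
    have hinv : Function.Injective fun y : Bits w => Function.update y t (xor (y t) (y c)) := by
      intro x y hxy
      have hj : ∀ j, j ≠ t → x j = y j := fun j hj => by
        simpa [hj] using congrFun hxy j
      funext j
      by_cases hjt : j = t
      · have h1 := congrFun hxy t
        simp only [Function.update_self, hj c h] at h1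
        rw [hjt]
        exact Bool.xor_left_inj.mp h1
      · exact hj j hjt
    ext x y
    rw [Matrix.mul_apply]
    simp only [Gate.mat, Matrix.conjTranspose_apply, Matrix.of_apply, apply_ite star, star_one, star_zero,
      mul_ite, mul_one, mul_zero]
    rw [Finset.sum_ite_eq' Finset.univ (Function.update y t (xor (y t) (y c)))]
    simp only [Finset.mem_univ, if_true, Matrix.one_apply]
    by_cases hxy : x = y
    · simp [hxy]
    · rw [if_neg hxy, if_neg]
      exact fun h' => hxy (hinv h').symm

namespace Circuit

variable {m n : ℕ}

theorem isometry (C : Circuit m n) :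
    (C.unitary * C.initIso)ᴴ * (C.unitary * C.initIso) = 1 := by
  have hU : ∀ (l : List (Gate C.wires)) (U : Op C.wires), Uᴴ * U = 1 →
      (l.foldl (fun U g => g.mat * U) U)ᴴ * l.foldl (fun U g => g.mat * U) U = 1 := by
    intro l
    induction l with
    | nil => exact fun U h => h
    | cons g l ih =>
      intro U h
      apply ih
      rw [Matrix.conjTranspose_mul, Matrix.mul_assoc, ← Matrix.mul_assoc g.matᴴ, g.mat_unitary,
        Matrix.one_mul, h]
  have hE : C.initIsoᴴ * C.initIso = 1 := by
    ext u v
    rw [Matrix.mul_apply]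
    simp only [initIso, Matrix.conjTranspose_apply, Matrix.of_apply, apply_ite star, star_one, star_zero,
      mul_ite, mul_one, mul_zero]
    rw [Finset.sum_ite_eq' Finset.univ (Function.extend C.inp v fun _ => false)]
    simp only [Finset.mem_univ, if_true, Matrix.one_apply]
    by_cases huv : u = v
    · simp [huv]
    · rw [if_neg huv, if_neg]
      intro h
      apply huv
      funext i
      simpa [C.inp.injective.extend_apply] using (congrFun h (C.inp i)).symm
  have h1 : C.unitaryᴴ * C.unitary = 1 := hU C.gates 1 (by simp)
  rw [Matrix.conjTranspose_mul, Matrix.mul_assoc, ← Matrix.mul_assoc C.unitaryᴴ, h1,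
    Matrix.one_mul, hE]

theorem traceOut_diag (C : Circuit m n) (σ : Op C.wires) (u : Bits n) :
    C.traceOut σ u u = ∑ x : Bits C.wires, if (fun i => x (C.out i)) = u then σ x x else 0 := by
  refine Finset.sum_congr rfl fun x _ => ?_
  rw [Finset.sum_eq_single x]
  · simp [funext_iff]
  · intro y _ hy
    rw [if_neg]
    rintro ⟨h1, h2, h3⟩
    apply hy
    funext j
    by_cases hj : j ∈ Set.range C.out
    · obtain ⟨i, rfl⟩ := hj
      rw [h1, h2]
    · exact (h3 j hj).symm
  · simp

theorem run_diag_sum (C : Circuit m n) (ρ : Op m) : ∑ u, C.run ρ u u = ρ.trace := by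
  simp only [run, traceOut_diag]
  rw [Finset.sum_comm]
  simp only [Finset.sum_ite_eq, Finset.mem_univ, if_true]
  change Matrix.trace _ = _
  rw [Matrix.trace_mul_comm, ← Matrix.mul_assoc, C.isometry, Matrix.one_mul]

theorem run_diag_nonneg (C : Circuit m n) {ρ : Op m} (hρ : ρ.PosSemidef) (u : Bits n) :
    0 ≤ C.run ρ u u := by
  rw [run, traceOut_diag]
  refine Finset.sum_nonneg fun x _ => ?_
  split_ifs
  · exact (hρ.mul_mul_conjTranspose_same _).diag_nonneg
  · exact le_rfl

theorem outDist_aux (C : Circuit m n) (x : Bits m) :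
    ∑ u, ENNReal.ofReal (C.run (classicalState (PMF.pure x)) u u).re = 1 := by
  have hpos : (classicalState (PMF.pure x)).PosSemidef :=
    Matrix.PosSemidef.diagonal fun y => by
      simp only [Pi.zero_apply]
      exact_mod_cast ENNReal.toReal_nonneg
  have htr : (classicalState (PMF.pure x)).trace = 1 := by
    simp [classicalState, Matrix.trace_diagonal, PMF.pure_apply, apply_ite ENNReal.toReal,
      apply_ite Complex.ofReal]
  rw [← ENNReal.ofReal_sum_of_nonneg fun u _ => (Complex.le_def.mp (C.run_diag_nonneg hpos u)).1,
    ← Complex.re_sum, C.run_diag_sum, htr]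
  simp

/-- The law of the bit string obtained by running the circuit on the basis state `|x⟩⟨x|` and
measuring all output qubits in the computational basis. -/
def outDist (C : Circuit m n) (x : Bits m) : PMF (Bits n) :=
  PMF.ofFintype (fun u => ENNReal.ofReal (C.run (classicalState (PMF.pure x)) u u).re)
    (C.outDist_aux x)

/-- Self-delimiting unary code of a number. -/
def encodeNat (k : ℕ) : List Bool := List.replicate k true ++ [false]

/-- Code of a gate: its kind and the wires on which it acts. -/
def encodeGate {w : ℕ} : Gate w → List Bool
  | .H i => encodeNat 1 ++ encodeNat i
  | .T i => encodeNat 2 ++ encodeNat i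
  | .CNOT c t _ => encodeNat 3 ++ encodeNat c ++ encodeNat t

/-- The description of a circuit as a bit string (its length is polynomial in the size). -/
def encode (C : Circuit m n) : List Bool :=
  encodeNat C.wires ++ encodeNat m ++ (List.ofFn fun i => encodeNat (C.inp i)).flatten ++
    encodeNat n ++ (List.ofFn fun i => encodeNat (C.out i)).flatten ++
    (C.gates.map encodeGate).flatten

end Circuit

/-! ### Polynomial-time quantum algorithms -/

/-- `A = {A_n}` is a QPT algorithm: the size of `A_n` is at most polynomial in `n`. -/
def IsQPT {m k : ℕ → ℕ} (A : ∀ n, Circuit (m n) (k n)) : Prop :=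
  ∃ p : Polynomial ℕ, ∀ n, (A n).size ≤ p.eval n

/-- A deterministic polynomial-time Turing machine maps `1ⁿ` to the description of `A_n`. -/
def IsUniform {m k : ℕ → ℕ} (A : ∀ n, Circuit (m n) (k n)) : Prop :=
  Nonempty (Turing.TM2ComputableInPolyTime (fun n : ℕ => List.replicate n true)
    (fun l : List Bool => l) (fun n => (A n).encode))

/-- A non-uniform QPT algorithm with `m n` input and `k n` output qubits: polynomial-size circuits
together with arbitrary quantum advice states. Ordinary QPT algorithms are those with
`adviceLen = 0`. -/
structure NonuniformQPT (m k : ℕ → ℕ) : Type where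
  adviceLen : ℕ → ℕ
  circuit : ∀ n, Circuit (m n + adviceLen n) (k n)
  advice : ∀ n, Op (adviceLen n)
  advice_density : ∀ n, IsDensity (advice n)
  poly : IsQPT circuit

/-- The output state of the algorithm on the input state `ρ`. -/
def NonuniformQPT.run {m k : ℕ → ℕ} (A : NonuniformQPT m k) (n : ℕ) (ρ : Op (m n)) : Op (k n) :=
  (A.circuit n).run (tensor ρ (A.advice n))

/-- The probability that an algorithm with one output qubit outputs `1` on the input state `ρ`. -/
def NonuniformQPT.accept {m : ℕ → ℕ} (A : NonuniformQPT m fun _ => 1) (n : ℕ) (ρ : Op (m n)) : ℝ :=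
  (A.run n ρ (fun _ => true) (fun _ => true)).re

/-- Negligible functions of the security parameter. -/
def Negligible (ε : ℕ → ℝ) : Prop :=
  Asymptotics.SuperpolynomialDecay atTop (fun n : ℕ => (n : ℝ)) ε

/-! ### Strong quantum pseudorandom generators -/

/-- `G` has pseudodeterminism `1 - μ`. -/
def Pseudodeterministic {ℓ : ℕ → ℕ} (G : ∀ n, Circuit n (ℓ n)) (μ : ℕ → ℝ) : Prop :=
  ∀ n, ∃ K : Finset (Bits n),
    1 - μ n ≤ (K.card : ℝ) / 2 ^ n ∧
    ∀ k ∈ K, ∃ y : Bits (ℓ n), 1 - μ n ≤ ((G n).outDist k y).toReal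

/-- Strong pseudodeterministic quantum pseudorandom generators with output length `ℓ`. The weak
security property is implied by the strong one. -/
structure IsStrongQPRG (ℓ : ℕ → ℕ) (G : ∀ n, Circuit n (ℓ n)) : Prop where
  qpt : IsQPT G
  uniform : IsUniform G
  pseudodeterminism : ∃ c : ℝ, 0 < c ∧ ∃ μ : ℕ → ℝ,
    (μ =O[atTop] fun n : ℕ => (n : ℝ) ^ (-c)) ∧ Pseudodeterministic G μ
  stretch : ∀ n, 0 < n → n < ℓ n
  strong_security : ∀ A : NonuniformQPT ℓ fun _ => 1,
    Negligible fun n =>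
      |A.accept n (classicalState ((PMF.uniformOfFintype (Bits n)).bind (G n).outDist)) -
        A.accept n (classicalState (PMF.uniformOfFintype (Bits (ℓ n))))|

/-! ### Randomized procedures with a step count

The honest parties are written in this monad, whose state counts elementary steps. -/

/-- Randomized procedures with result in `α` and a running step count. -/
abbrev Timed (α : Type) : Type := StateT ℕ PMF α

namespace Timed

/-- Spend `c` steps. -/
def tick (c : ℕ) : Timed Unit := fun t => PMF.pure ((), t + c)

/-- Sample from a distribution (at no cost; only used below together with `tick`). -/
def draw {α : Type} (μ : PMF α) : Timed α := fun t => μ.map fun a => (a, t)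

/-- The law of the result. -/
def dist {α : Type} (x : Timed α) : PMF α := (x.run 0).map Prod.fst

/-- Every execution takes at most `T` steps. -/
def TimeLE {α : Type} (x : Timed α) (T : ℕ) : Prop := ∀ a ∈ (x.run 0).support, a.2 ≤ T

/-- Sampling a uniform string of `m` bits: `m` steps. -/
def sampleBits (m : ℕ) : Timed (Bits m) := do
  tick m
  draw (PMF.uniformOfFintype (Bits m))

/-- Running a quantum circuit on a classical input and measuring its output: as many steps as the
size of the circuit. -/
def eval {m n : ℕ} (C : Circuit m n) (x : Bits m) : Timed (Bits n) := do
  tick C.size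
  draw (C.outDist x)

/-- The bitwise exclusive or: `m` steps. -/
def xorBits {m : ℕ} (x y : Bits m) : Timed (Bits m) := do
  tick m
  pure fun j => xor (x j) (y j)

/-- The test whether two strings of `m` bits are equal: `m` steps. -/
def eqBits {m : ℕ} (x y : Bits m) : Timed Bool := do
  tick m
  pure (decide (x = y))

/-- The number of ones among `m` bits: `m` steps. -/
def count {m : ℕ} (e : Bits m) : Timed ℕ := do
  tick m
  pure (Finset.univ.filter fun i => e i = true).card

/-- The loop `for i = 1, …, m`, collecting the results; one additional step per iteration. -/
def forFin {α : Type} : (m : ℕ) → (Fin m → Timed α) → Timed (Fin m → α)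
  | 0, _ => pure Fin.elim0
  | m + 1, f => do
    tick 1
    let a ← f 0
    let v ← forFin m fun i => f i.succ
    pure (Fin.cons a v)

end Timed

/-! ### Bit commitments with classical communication -/

/-- Bit commitment schemes in which all messages are classical, the commit phase consists of a
message of the receiver followed by one of the committer, and the reveal phase of one message of
the committer (which the committer keeps from the commit phase on) and a check by the receiver. -/
structure CommitmentScheme : Type 1 where
  /-- length of the receiver's message -/
  qLen : ℕ → ℕ
  /-- length of the committer's message in the commit phase -/
  cLen : ℕ → ℕ
  /-- decommitment messages -/
  Opening : ℕ → Type
  /-- the receiver produces its message -/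
  challenge : ∀ n, Timed (Bits (qLen n))
  /-- on a bit and the receiver's message, the committer produces its message and the decommitment -/
  commit : ∀ n, Bool → Bits (qLen n) → Timed (Bits (cLen n) × Opening n)
  /-- the receiver's check in the reveal phase; `none` is the rejection `⊥` -/
  verify : ∀ n, Bits (qLen n) → Bits (cLen n) → Opening n → Timed (Option Bool)

namespace CommitmentScheme

variable (S : CommitmentScheme)

/-- The honest committer and the honest receiver run in polynomial time. -/
def Efficient : Prop :=
  ∃ p : Polynomial ℕ, ∀ n,
    (S.challenge n).TimeLE (p.eval n) ∧
    (∀ b r, (S.commit n b r).TimeLE (p.eval n)) ∧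
    (∀ r c d, (S.verify n r c d).TimeLE (p.eval n))

/-- The receiver's output in an execution of both phases by the honest parties. -/
def honestExp (n : ℕ) (b : Bool) : PMF (Option Bool) := do
  let r ← (S.challenge n).dist
  let cd ← (S.commit n b r).dist
  (S.verify n r cd.1 cd.2).dist

def Correct : Prop :=
  ∃ ε : ℕ → ℝ, Negligible ε ∧ ∀ n b, 1 - ε n ≤ (S.honestExp n b (some b)).toReal

/-- The part of a state of `q + s` qubits that belongs to the outcome `r` of a measurement of the
first `q` qubits: the post-measurement state of the other qubits times the probability of `r`. -/
def outcomePart {q s : ℕ} (σ : Op (q + s)) (r : Bits q) : Op s := Matrix.of fun u v =>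
  σ (Fin.append r u) (Fin.append r v)

/-- The state of a malicious receiver after the commit phase with the honest committer on the bit
`b`. The receiver prepares `qLen n + s n` qubits, its message `r` is the result of measuring the
first `qLen n` of them, and in the end it holds the committer's message and its other qubits. -/
def receiverState {s : ℕ → ℕ} (R : NonuniformQPT (fun _ => 0) fun n => S.qLen n + s n)
    (n : ℕ) (b : Bool) : Op (S.cLen n + s n) :=
  ∑ r : Bits (S.qLen n),
    tensor (classicalState ((S.commit n b r).dist.map Prod.fst)) (outcomePart (R.run n 1) r)

/-- No QPT distinguisher can tell from the state of a malicious QPT receiver after the commit phase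
which bit was committed. Later computations of the receiver are part of the distinguisher. -/
def ComputationallyHiding : Prop :=
  ∀ (s : ℕ → ℕ) (R : NonuniformQPT (fun _ => 0) fun n => S.qLen n + s n)
    (D : NonuniformQPT (fun n => S.cLen n + s n) fun _ => 1),
    Negligible fun n =>
      |D.accept n (S.receiverState R n false) - D.accept n (S.receiverState R n true)|

/-- A malicious committer answers the receiver's message with a message and decommitments for two
reveal phases, which the receiver carries out independently; `true` means that their outputs are
`0` and `1`. As all messages are classical, a computationally unbounded (quantum) committer is just
an arbitrary conditional distribution of these messages given the receiver's. -/
def bindingExp (n : ℕ)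
    (C : Bits (S.qLen n) → PMF (Bits (S.cLen n) × S.Opening n × S.Opening n)) : PMF Bool := do
  let r ← (S.challenge n).dist
  let m ← C r
  let v₀ ← (S.verify n r m.1 m.2.1).dist
  let v₁ ← (S.verify n r m.1 m.2.2).dist
  pure (decide (v₀ = some false) && decide (v₁ = some true))

def StatisticallyBinding : Prop :=
  ∃ ε : ℕ → ℝ, Negligible ε ∧
    ∀ n (C : Bits (S.qLen n) → PMF (Bits (S.cLen n) × S.Opening n × S.Opening n)),
      (S.bindingExp n C true).toReal ≤ ε n

end CommitmentScheme

/-! ### The construction -/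

/-- The concatenation `y₁ || ⋯ || yₙ`. -/
def concat {n m : ℕ} (y : Fin n → Bits m) : Bits (n * m) := fun j =>
  y (finProdFinEquiv.symm j).1 (finProdFinEquiv.symm j).2

/-- The `i`-th block of a concatenation. -/
def block {n m : ℕ} (c : Bits (n * m)) (i : Fin n) : Bits m := fun j => c (finProdFinEquiv (i, j))

/-- The Naor-style commitment scheme built from `G`. -/
def naorCommitment (G : ∀ n, Circuit n (3 * n)) : CommitmentScheme where
  qLen n := 3 * n
  cLen n := n * (3 * n)
  Opening n := Bool × (Fin n → Bits n)
  challenge n := Timed.sampleBits (3 * n)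
  commit n b r := do
    let k ← Timed.forFin n fun _ => Timed.sampleBits n
    let y ← Timed.forFin n fun i => do
      let g ← Timed.eval (G n) (k i)
      if b then Timed.xorBits g r else pure g
    pure (concat y, (b, k))
  verify n r c d := do
    let e ← Timed.forFin n fun i => do
      let g ← Timed.eval (G n) (d.2 i)
      let z ← if d.1 then Timed.xorBits g r else pure g
      Timed.eqBits (block c i) z
    let N ← Timed.count e
    pure (if 2 * n ≤ 3 * N then some d.1 else none)

end QCommit

end

/-!
Correctness: two runs of the generator on a seed from the good set disagree with probability at most
`2μ`, and a seed is bad with probability at most `μ`. Once `3μ ≤ 1/64`, the bound on the exponential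
moment of the number of disagreeing blocks shows that a third of the `n` blocks disagree with
probability at most `2⁻ⁿ`.

Statistical binding: if some block opens to both bits with probability more than `1/64`, then `r` is
the exclusive or of two outputs that each have probability more than `1/64` under some seed. There
are at most `64 * 2ⁿ` such pairs of a seed and an output, hence at most `2¹² * 2²ⁿ` such `r` among
the `2³ⁿ` possible ones. For every other `r`, a successful cheat needs two sets of two thirds of the
blocks to be accepted; they share a third of the blocks, which again has probability at most `2⁻ⁿ`.

Computational hiding: masking by `r` preserves the uniform distribution, so both commitments are
compared with a uniform string, block by block. A distinguisher between two neighbouring hybrids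
attacks the generator once the other blocks and the mask are hardwired into it by bit flips
`X = H T⁴ H` and the receiver's state after its measurement is supplied as advice.
-/

noncomputable section

namespace QCommit

open Matrix Filter
open scoped ComplexOrder ENNReal Finset

section Probability

variable {α β : Type*}

theorem sum_apply_eq_one [Fintype α] (μ : PMF α) : ∑ a, μ a = 1 :=
  (tsum_fintype _).symm.trans μ.tsum_coe

theorem sum_toReal_apply_eq_one [Fintype α] (μ : PMF α) : ∑ a, (μ a).toReal = 1 := by
  rw [← ENNReal.toReal_sum fun a _ => μ.apply_ne_top a, sum_apply_eq_one, ENNReal.toReal_one]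

theorem map_uniformOfFintype_equiv [Fintype α] [Nonempty α] [Fintype β] [Nonempty β]
    (e : α ≃ β) : (PMF.uniformOfFintype α).map e = PMF.uniformOfFintype β := by
  ext y
  rw [PMF.map_apply, tsum_eq_single (e.symm y)] <;>
    simp +contextual [Fintype.card_congr e, Equiv.eq_symm_apply, eq_comm]

theorem abs_sum_mul_le {s : Finset α} {p f : α → ℝ} {c : ℝ} (hp : ∀ a ∈ s, 0 ≤ p a)
    (hsum : ∑ a ∈ s, p a = 1) (hf : ∀ a ∈ s, |f a| ≤ c) : |∑ a ∈ s, p a * f a| ≤ c :=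
  calc |∑ a ∈ s, p a * f a| ≤ ∑ a ∈ s, |p a * f a| := Finset.abs_sum_le_sum_abs _ _
    _ ≤ ∑ a ∈ s, p a * c := by
      gcongr with a ha
      rw [abs_mul, abs_of_nonneg (hp a ha)]
      exact mul_le_mul_of_nonneg_left (hf a ha) (hp a ha)
    _ = c := by rw [← Finset.sum_mul, hsum, one_mul]

/-! ### Expectations -/

section Expectation

variable {V W : Type*} [AddCommGroup V] [Module ℝ V] [AddCommGroup W] [Module ℝ W]

/-- The expectation of a vector-valued random variable on a finite probability space. Its values
may be operators, on which there is no canonical norm and hence no Bochner integral. -/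
def expectation [Fintype α] (μ : PMF α) (f : α → V) : V := ∑ a, (μ a).toReal • f a

theorem expectation_bind [Fintype α] [Fintype β] (μ : PMF α) (κ : α → PMF β) (f : β → V) :
    expectation (μ.bind κ) f = expectation μ fun a => expectation (κ a) f := by
  have hbind (b : β) : (μ.bind κ b).toReal = ∑ a, (μ a).toReal * (κ a b).toReal := by
    rw [PMF.bind_apply, tsum_fintype, ENNReal.toReal_sum fun a _ =>
      ENNReal.mul_ne_top (μ.apply_ne_top a) ((κ a).apply_ne_top b)]
    simp only [ENNReal.toReal_mul]
  simp only [expectation, hbind, Finset.sum_smul, Finset.smul_sum, mul_smul]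
  exact Finset.sum_comm

theorem expectation_pure [Fintype α] (a : α) (f : α → V) :
    expectation (PMF.pure a) f = f a := by
  classical
  rw [expectation, Finset.sum_eq_single a (fun b _ hb => by simp [hb]) (by simp)]
  simp

theorem expectation_map [Fintype α] [Fintype β] (μ : PMF α) (g : α → β) (f : β → V) :
    expectation (μ.map g) f = expectation μ (f ∘ g) := by
  rw [← PMF.bind_pure_comp, expectation_bind]
  simp only [Function.comp_apply, expectation_pure, Function.comp_def]

theorem map_expectation [Fintype α] (L : V →ₗ[ℝ] W) (μ : PMF α) (f : α → V) :
    L (expectation μ f) = expectation μ fun a => L (f a) := by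
  simp only [expectation, map_sum, map_smul]

theorem expectation_comm [Fintype α] [Fintype β] (μ : PMF α) (ν : PMF β) (f : α → β → V) :
    expectation μ (fun a => expectation ν (f a)) =
      expectation ν fun b => expectation μ fun a => f a b := by
  simp only [expectation, Finset.smul_sum]
  rw [Finset.sum_comm]
  exact Finset.sum_congr rfl fun b _ => Finset.sum_congr rfl fun a _ => smul_comm _ _ _

theorem expectation_sub [Fintype α] (μ : PMF α) (f g : α → V) :
    (expectation μ fun a => f a - g a) = expectation μ f - expectation μ g := by
  simp only [expectation, smul_sub, Finset.sum_sub_distrib]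

theorem abs_expectation_le [Fintype α] (μ : PMF α) {f : α → ℝ} {c : ℝ} (hf : ∀ a, |f a| ≤ c) :
    |expectation μ f| ≤ c :=
  abs_sum_mul_le (fun _ _ => ENNReal.toReal_nonneg) (sum_toReal_apply_eq_one μ) fun a _ => hf a

end Expectation

/-! ### Independent coordinates -/

section Product

variable {ι : Type*} [Fintype ι] [DecidableEq ι] {A B : ι → Type*} [∀ i, Fintype (A i)]
  [∀ i, Fintype (B i)]

/-- The law of a random vector with independent coordinates, the `i`-th of which has law `μ i`. -/
def productPMF (μ : ∀ i, PMF (A i)) : PMF (∀ i, A i) :=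
  PMF.ofFintype (fun v => ∏ i, μ i (v i)) <| by
    rw [← Fintype.piFinset_univ, ← Finset.prod_univ_sum]
    exact Finset.prod_eq_one fun i _ => sum_apply_eq_one (μ i)

theorem productPMF_apply (μ : ∀ i, PMF (A i)) (v : ∀ i, A i) :
    productPMF μ v = ∏ i, μ i (v i) :=
  PMF.ofFintype_apply _ v

theorem productPMF_pure (v : ∀ i, A i) : (productPMF fun i => PMF.pure (v i)) = PMF.pure v := by
  classical
  ext w
  simp only [productPMF_apply, PMF.pure_apply, Finset.prod_ite_zero, Finset.prod_const_one,
    funext_iff, Finset.mem_univ, true_implies]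

theorem productPMF_bind (μ : ∀ i, PMF (A i)) (κ : ∀ i, A i → PMF (B i)) :
    ((productPMF μ).bind fun v => productPMF fun i => κ i (v i)) =
      productPMF fun i => (μ i).bind (κ i) := by
  ext w
  simp only [PMF.bind_apply, tsum_fintype, productPMF_apply, ← Finset.prod_mul_distrib]
  rw [← Fintype.piFinset_univ, Finset.prod_univ_sum]

theorem productPMF_map (μ : ∀ i, PMF (A i)) (f : ∀ i, A i → B i) :
    ((productPMF μ).map fun v i => f i (v i)) = productPMF fun i => (μ i).map (f i) := by
  simp only [← PMF.bind_pure_comp, Function.comp_def, ← productPMF_bind, productPMF_pure]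

theorem productPMF_pair (μ : ∀ i, PMF (A i)) (ν : ∀ i, PMF (B i)) :
    ((productPMF μ).bind fun v => (productPMF ν).map fun w i => (v i, w i)) =
      productPMF fun i => (μ i).bind fun a => (ν i).map (Prod.mk a) := by
  simp only [← productPMF_bind, ← productPMF_map]

theorem productPMF_cons {n : ℕ} [Fintype α] (μ : Fin (n + 1) → PMF α) :
    productPMF μ =
      (μ 0).bind fun a => (productPMF fun i : Fin n => μ i.succ).map (Fin.cons a) := by
  ext v
  have hcons (a : α) (w : Fin n → α) : v = Fin.cons a w ↔ v 0 = a ∧ Fin.tail v = w := by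
    rw [← Fin.cons_self_tail v, Fin.cons_inj, Fin.cons_zero, Fin.tail_cons]
  classical
  simp only [PMF.bind_apply, PMF.map_apply, tsum_fintype, productPMF_apply, Fin.prod_univ_succ,
    hcons, ite_and, Finset.sum_ite_irrel, Finset.sum_const_zero, Finset.sum_ite_eq,
    Finset.mem_univ, if_true, mul_ite, mul_zero]
  rfl

theorem productPMF_uniform [Fintype α] [Nonempty α] :
    (productPMF fun _ : ι => PMF.uniformOfFintype α) = PMF.uniformOfFintype (ι → α) := by
  ext v
  simp [productPMF_apply, ENNReal.inv_pow]

theorem abs_expectation_productPMF_sub_le [Fintype α] {m : ℕ} (μ ν : Fin m → PMF α)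
    (f : (Fin m → α) → ℝ) {δ : ℝ}
    (hδ : ∀ j w, |expectation (μ j) (fun a => f (Function.update w j a)) -
      expectation (ν j) fun a => f (Function.update w j a)| ≤ δ) :
    |expectation (productPMF μ) f - expectation (productPMF ν) f| ≤ m * δ := by
  induction m with
  | zero => simp [Subsingleton.elim μ ν]
  | succ m ih =>
    have hcons (μ : Fin (m + 1) → PMF α) : expectation (productPMF μ) f = expectation (μ 0) fun a =>
        expectation (productPMF fun i : Fin m => μ i.succ) fun w => f (Fin.cons a w) := by
      simp only [productPMF_cons, expectation_bind, expectation_map, Function.comp_def]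
    let hybrid : ℝ := expectation (μ 0) fun a =>
      expectation (productPMF fun i : Fin m => ν i.succ) fun w => f (Fin.cons a w)
    have htail : |expectation (productPMF μ) f - hybrid| ≤ m * δ := by
      rw [hcons, ← expectation_sub]
      refine abs_expectation_le _ fun a => ih _ _ _ fun j w => ?_
      simpa only [Fin.cons_update] using hδ j.succ (Fin.cons a w)
    have hhead : |hybrid - expectation (productPMF ν) f| ≤ δ := by
      obtain ⟨a₀, -⟩ := (μ 0).support_nonempty
      rw [hcons, expectation_comm (ν 0)]
      simp only [hybrid, expectation_comm (μ 0), ← expectation_sub]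
      refine abs_expectation_le _ fun w => ?_
      simpa only [Fin.update_cons_zero] using hδ 0 (Fin.cons a₀ w)
    calc |expectation (productPMF μ) f - expectation (productPMF ν) f|
        ≤ |expectation (productPMF μ) f - hybrid| + |hybrid - expectation (productPMF ν) f| :=
          abs_sub_le _ _ _
      _ ≤ m * δ + δ := add_le_add htail hhead
      _ = (m + 1 : ℕ) * δ := by push_cast; ring

end Product

/-! ### Probabilities of events -/

section Events

theorem toOuterMeasure_add_compl (μ : PMF α) (s : Set α) :
    μ.toOuterMeasure s + μ.toOuterMeasure sᶜ = 1 := by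
  have hs : μ.toOuterMeasure.IsCaratheodory s :=
    (PMF.toOuterMeasure_caratheodory μ).ge s MeasurableSpace.measurableSet_top
  have huniv : μ.toOuterMeasure Set.univ = 1 :=
    (PMF.toOuterMeasure_apply_eq_one_iff μ Set.univ).mpr (Set.subset_univ _)
  rw [← huniv, hs Set.univ, Set.univ_inter, ← Set.compl_eq_univ_sdiff]

theorem toOuterMeasure_le_one (μ : PMF α) (s : Set α) : μ.toOuterMeasure s ≤ 1 :=
  (toOuterMeasure_add_compl μ s).le.trans' le_self_add

theorem toOuterMeasure_compl_le_ofReal_iff (μ : PMF α) (s : Set α) {δ : ℝ} (hδ : 0 ≤ δ) :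
    μ.toOuterMeasure sᶜ ≤ ENNReal.ofReal δ ↔ 1 - δ ≤ (μ.toOuterMeasure s).toReal := by
  have htop (t : Set α) : μ.toOuterMeasure t ≠ ∞ :=
    ((toOuterMeasure_le_one μ t).trans_lt ENNReal.one_lt_top).ne
  have hadd := congrArg ENNReal.toReal (toOuterMeasure_add_compl μ s)
  rw [ENNReal.toReal_add (htop _) (htop _), ENNReal.toReal_one] at hadd
  rw [ENNReal.le_ofReal_iff_toReal_le (htop _) hδ]
  constructor <;> intro h <;> linarith

theorem toOuterMeasure_bind_le_add (μ : PMF α) (κ : α → PMF β) {t : Set α} {s : Set β} {c : ℝ≥0∞}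
    (h : ∀ a ∉ t, (κ a).toOuterMeasure s ≤ c) :
    (μ.bind κ).toOuterMeasure s ≤ μ.toOuterMeasure t + c := by
  have hle (a : α) : μ a * (κ a).toOuterMeasure s ≤ t.indicator μ a + μ a * c := by
    by_cases ha : a ∈ t
    · rw [Set.indicator_of_mem ha]
      exact (mul_le_of_le_one_right' (toOuterMeasure_le_one _ _)).trans le_self_add
    · rw [Set.indicator_of_notMem ha, zero_add]
      gcongr
      exact h a ha
  rw [PMF.toOuterMeasure_bind_apply]
  calc ∑' a, μ a * (κ a).toOuterMeasure s ≤ ∑' a, (t.indicator μ a + μ a * c) :=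
        ENNReal.tsum_le_tsum hle
    _ = μ.toOuterMeasure t + c := by
      rw [ENNReal.tsum_add, ENNReal.tsum_mul_right, μ.tsum_coe, one_mul, PMF.toOuterMeasure_apply]

theorem toOuterMeasure_bind_le (μ : PMF α) (κ : α → PMF β) {s : Set β} {c : ℝ≥0∞}
    (h : ∀ a, (κ a).toOuterMeasure s ≤ c) : (μ.bind κ).toOuterMeasure s ≤ c := by
  simpa using toOuterMeasure_bind_le_add μ κ (t := ∅) fun a _ => h a

/-- Markov's inequality for the variable `c ^ (k * #{i | v i ∈ s i})`, whose expectation factors. -/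
theorem pow_mul_productPMF_frequent_le {ι : Type*} [Fintype ι] [DecidableEq ι] {A : ι → Type*}
    [∀ i, Fintype (A i)] (μ : ∀ i, PMF (A i)) (s : ∀ i, Set (A i))
    [∀ i, DecidablePred (· ∈ s i)] {p c : ℝ≥0∞} (hc : 1 ≤ c) (k N : ℕ)
    (hp : ∀ i, (μ i).toOuterMeasure (s i) ≤ p) :
    c ^ N * (productPMF μ).toOuterMeasure {v | N ≤ k * #{i | v i ∈ s i}} ≤
      (1 + c ^ k * p) ^ Fintype.card ι := by
  have hcoord (i : ι) : ∑ a, μ i a * (if a ∈ s i then c ^ k else 1) ≤ 1 + c ^ k * p := by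
    calc ∑ a, μ i a * (if a ∈ s i then c ^ k else 1)
        ≤ ∑ a, (μ i a + c ^ k * (s i).indicator (μ i) a) := by
          gcongr with a
          by_cases ha : a ∈ s i <;> simp [ha, mul_comm]
      _ = 1 + c ^ k * (μ i).toOuterMeasure (s i) := by
          rw [Finset.sum_add_distrib, ← Finset.mul_sum, ← PMF.toOuterMeasure_apply_fintype,
            sum_apply_eq_one]
      _ ≤ 1 + c ^ k * p := by
          gcongr
          exact hp i
  have hmarkov (v : ∀ i, A i) :
      c ^ N * {v | N ≤ k * #{i | v i ∈ s i}}.indicator (productPMF μ) v ≤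
        ∏ i, μ i (v i) * (if v i ∈ s i then c ^ k else 1) := by
    rw [Finset.prod_mul_distrib, ← productPMF_apply, Finset.prod_ite, Finset.prod_const,
      Finset.prod_const_one, mul_one, ← pow_mul, mul_comm]
    by_cases hv : N ≤ k * #{i | v i ∈ s i}
    · rw [Set.indicator_of_mem (by exact hv)]
      gcongr
    · rw [Set.indicator_of_notMem (by exact hv), zero_mul]
      exact zero_le
  calc c ^ N * (productPMF μ).toOuterMeasure {v | N ≤ k * #{i | v i ∈ s i}}
      ≤ ∑ v : ∀ i, A i, ∏ i, μ i (v i) * (if v i ∈ s i then c ^ k else 1) := by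
        rw [PMF.toOuterMeasure_apply_fintype, Finset.mul_sum]
        exact Finset.sum_le_sum fun v _ => hmarkov v
    _ = ∏ i, ∑ a, μ i a * (if a ∈ s i then c ^ k else 1) := by
        rw [Finset.prod_univ_sum, Fintype.piFinset_univ]
    _ ≤ (1 + c ^ k * p) ^ Fintype.card ι := Finset.prod_le_pow_card _ _ _ fun i _ => hcoord i

theorem productPMF_third_le {ι : Type*} [Fintype ι] [DecidableEq ι] {A : ι → Type*}
    [∀ i, Fintype (A i)] (μ : ∀ i, PMF (A i)) (s : ∀ i, Set (A i))
    [∀ i, DecidablePred (· ∈ s i)] (hp : ∀ i, (μ i).toOuterMeasure (s i) ≤ 64⁻¹) :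
    (productPMF μ).toOuterMeasure {v | Fintype.card ι ≤ 3 * #{i | v i ∈ s i}} ≤
      2⁻¹ ^ Fintype.card ι := by
  have h := pow_mul_productPMF_frequent_le μ s (c := 4) (by norm_num) 3 (Fintype.card ι) hp
  have hbase : (1 : ℝ≥0∞) + 4 ^ 3 * 64⁻¹ = 2 := by
    rw [show (4 : ℝ≥0∞) ^ 3 = 64 by norm_num, ENNReal.mul_inv_cancel (by simp) (by simp)]
    norm_num
  rw [hbase, show (4 : ℝ≥0∞) = 2 * 2 by norm_num, mul_pow, mul_assoc] at h
  rw [← ENNReal.inv_pow, ENNReal.le_inv_iff_mul_le, mul_comm]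
  exact (ENNReal.mul_le_mul_iff_right (by simp) (by simp)).mp (h.trans_eq (mul_one _).symm)

end Events

end Probability

/-! ### Laws and running times of procedures -/

namespace Timed

variable {α β : Type}

/-- Started at any step count, the procedure `x` returns a result with law `μ` and spends at most
`T` steps. -/
structure RunsWithin (x : Timed α) (μ : PMF α) (T : ℕ) : Prop where
  law : ∀ t, (x.run t).map Prod.fst = μ
  steps : ∀ t, ∀ p ∈ (x.run t).support, p.2 ≤ t + T

namespace RunsWithin

theorem dist_eq {x : Timed α} {μ : PMF α} {T : ℕ} (h : RunsWithin x μ T) : x.dist = μ := h.law 0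

theorem timeLE {x : Timed α} {μ : PMF α} {T S : ℕ} (h : RunsWithin x μ T) (hTS : T ≤ S) :
    x.TimeLE S := fun p hp => (h.steps 0 p hp).trans (by omega)

theorem mono {x : Timed α} {μ : PMF α} {T S : ℕ} (h : RunsWithin x μ T) (hTS : T ≤ S) :
    RunsWithin x μ S :=
  ⟨h.law, fun t p hp => (h.steps t p hp).trans (by omega)⟩

theorem bind {x : Timed α} {f : α → Timed β} {μ : PMF α} {κ : α → PMF β} {T S : ℕ}
    (hx : RunsWithin x μ T) (hf : ∀ a, RunsWithin (f a) (κ a) S) :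
    RunsWithin (x >>= f) (μ.bind κ) (T + S) where
  law t := by
    change ((x.run t).bind fun p => (f p.1).run p.2).map Prod.fst = _
    rw [PMF.map_bind, ← hx.law t, PMF.bind_map]
    simp only [(hf _).law, Function.comp_def]
  steps t q hq := by
    obtain ⟨p, hp, hpq⟩ :=
      (PMF.mem_support_bind_iff (x.run t) (fun p => (f p.1).run p.2) q).mp hq
    have hT := hx.steps t p hp
    have hS := (hf p.1).steps p.2 q hpq
    omega

end RunsWithin

theorem runsWithin_pure (a : α) : RunsWithin (pure a) (PMF.pure a) 0 where
  law t := PMF.pure_map Prod.fst (a, t)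
  steps t p hp := (congrArg Prod.snd ((PMF.mem_support_pure_iff (a, t) p).mp hp)).le

theorem runsWithin_draw (μ : PMF α) : RunsWithin (draw μ) μ 0 where
  law t := (PMF.map_comp (fun a => (a, t)) μ Prod.fst).trans μ.map_id
  steps t p hp := by
    obtain ⟨a, -, rfl⟩ := (PMF.mem_support_map_iff (fun a => (a, t)) μ p).mp hp
    exact le_rfl

theorem runsWithin_tick (c : ℕ) : RunsWithin (tick c) (PMF.pure ()) c where
  law t := PMF.pure_map Prod.fst ((), t + c)
  steps t p hp := (congrArg Prod.snd ((PMF.mem_support_pure_iff ((), t + c) p).mp hp)).le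

theorem RunsWithin.tick_bind {x : Timed α} {μ : PMF α} {T : ℕ} (hx : RunsWithin x μ T) (c : ℕ) :
    RunsWithin (tick c >>= fun _ => x) μ (c + T) := by
  simpa only [PMF.pure_bind] using (runsWithin_tick c).bind fun _ => hx

theorem runsWithin_sampleBits (m : ℕ) :
    RunsWithin (sampleBits m) (PMF.uniformOfFintype (Bits m)) m :=
  (runsWithin_draw _).tick_bind m

theorem runsWithin_eval {m n : ℕ} (C : Circuit m n) (x : Bits m) :
    RunsWithin (eval C x) (C.outDist x) C.size :=
  (runsWithin_draw _).tick_bind C.size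

theorem runsWithin_xorBits {m : ℕ} (x y : Bits m) :
    RunsWithin (xorBits x y) (PMF.pure fun j => xor (x j) (y j)) m :=
  (runsWithin_pure _).tick_bind m

theorem runsWithin_eqBits {m : ℕ} (x y : Bits m) :
    RunsWithin (eqBits x y) (PMF.pure (decide (x = y))) m :=
  (runsWithin_pure _).tick_bind m

theorem runsWithin_count {m : ℕ} (e : Bits m) :
    RunsWithin (count e) (PMF.pure #{i | e i = true}) m :=
  (runsWithin_pure _).tick_bind m

theorem runsWithin_forFin [Fintype α] {T : ℕ} : {m : ℕ} → {f : Fin m → Timed α} →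
    {μ : Fin m → PMF α} → (∀ i, RunsWithin (f i) (μ i) T) →
    RunsWithin (forFin m f) (productPMF μ) (m * (T + 1))
  | 0, f, μ, _ => by
    have hμ : productPMF μ = PMF.pure Fin.elim0 := by
      rw [← productPMF_pure]
      exact congrArg productPMF (Subsingleton.elim _ _)
    rw [hμ, zero_mul]
    exact runsWithin_pure _
  | m + 1, f, μ, h => by
    have hstep := ((h 0).bind fun a => (runsWithin_forFin fun i => h i.succ).bind fun v =>
      runsWithin_pure (Fin.cons a v : Fin (m + 1) → α)).tick_bind 1
    rw [productPMF_cons]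
    simp only [← PMF.bind_pure_comp]
    exact hstep.mono (by ring_nf; rfl)

end Timed

/-! ### The procedures of the scheme -/

/-- Conditional masking: the exclusive or of `x` with the receiver's message `r` if the committed
bit `b` is `1`, and `x` itself otherwise. -/
def maskBits {m : ℕ} (b : Bool) (r x : Bits m) : Bits m := if b then fun j => xor (x j) (r j) else x

theorem maskBits_involutive {m : ℕ} (b : Bool) (r : Bits m) :
    Function.Involutive (maskBits b r) := fun x => by
  cases b <;> simp [maskBits]

/-- The procedure that computes `maskBits`. -/
def Timed.mask {m : ℕ} (b : Bool) (r x : Bits m) : Timed (Bits m) :=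
  if b then Timed.xorBits x r else pure x

theorem Timed.runsWithin_mask {m : ℕ} (b : Bool) (r x : Bits m) :
    Timed.RunsWithin (Timed.mask b r x) (PMF.pure (maskBits b r x)) m := by
  cases b
  · exact (Timed.runsWithin_pure x).mono (Nat.zero_le m)
  · exact Timed.runsWithin_xorBits x r

/-- The law of the comparison of a block `y` of a commitment to `b` with a fresh evaluation of the
generator `C` on the revealed seed `k`. -/
def matchPMF {m n : ℕ} (C : Circuit m n) (b : Bool) (r y : Bits n) (k : Bits m) : PMF Bool :=
  (C.outDist k).map fun g => decide (y = maskBits b r g)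

/-- The receiver's output after the comparisons `e` with the opening of a commitment to `b`. -/
def verdict {n : ℕ} (b : Bool) (e : Bits n) : Option Bool :=
  if 2 * n ≤ 3 * #{i | e i = true} then some b else none

section Procedures

open Timed

variable (G : ∀ n, Circuit n (3 * n)) (n : ℕ)

theorem runsWithin_challenge :
    RunsWithin ((naorCommitment G).challenge n) (PMF.uniformOfFintype (Bits (3 * n))) (3 * n) :=
  runsWithin_sampleBits _

theorem runsWithin_commit (b : Bool) (r : Bits (3 * n)) :
    RunsWithin ((naorCommitment G).commit n b r)
      ((PMF.uniformOfFintype (Fin n → Bits n)).bind fun k =>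
        (productPMF fun i => ((G n).outDist (k i)).map (maskBits b r)).map fun y =>
          (concat y, (b, k)))
      (n * (n + 1) + n * ((G n).size + 3 * n + 1)) := by
  rw [← productPMF_uniform]
  simp only [← PMF.bind_pure_comp]
  exact (runsWithin_forFin fun _ => runsWithin_sampleBits n).bind fun k =>
    (runsWithin_forFin fun i => (runsWithin_eval (G n) (k i)).bind fun g =>
      runsWithin_mask b r g).bind fun y => runsWithin_pure _

theorem runsWithin_verify (r : Bits (3 * n)) (c : Bits (n * (3 * n)))
    (d : Bool × (Fin n → Bits n)) :
    RunsWithin ((naorCommitment G).verify n r c d)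
      ((productPMF fun i => matchPMF (G n) d.1 r (block c i) (d.2 i)).map (verdict d.1))
      (n * ((G n).size + (3 * n + 3 * n) + 1) + n) := by
  have hprocedure : (naorCommitment G).verify n r c d =
      (forFin n fun i => eval (G n) (d.2 i) >>= fun g => mask d.1 r g >>= eqBits (block c i)) >>=
        fun e => count e >>= fun N => pure (if 2 * n ≤ 3 * N then some d.1 else none) := by
    obtain ⟨b, k⟩ := d
    cases b <;> rfl
  have hruns := (runsWithin_forFin fun i => (runsWithin_eval (G n) (d.2 i)).bind fun g =>
    (runsWithin_mask d.1 r g).bind fun z => runsWithin_eqBits (block c i) z).bind fun e =>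
      (runsWithin_count e).bind fun N =>
        runsWithin_pure (if 2 * n ≤ 3 * N then some d.1 else none)
  simp only [PMF.pure_bind] at hruns
  rw [hprocedure]
  exact hruns

theorem efficient_naorCommitment (hG : IsQPT G) : (naorCommitment G).Efficient := by
  obtain ⟨p, hp⟩ := hG
  refine ⟨3 * .X + .X * (.X + 1) + .X * (p + 6 * .X + 1) + .X, fun n => ?_⟩
  have heval : (3 * .X + .X * (.X + 1) + .X * (p + 6 * .X + 1) + .X : Polynomial ℕ).eval n =
      3 * n + n * (n + 1) + n * (p.eval n + 6 * n + 1) + n := by simp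
  have hsize : n * ((G n).size + 6 * n + 1) ≤ n * (p.eval n + 6 * n + 1) := by
    gcongr
    exact hp n
  rw [heval]
  refine ⟨(runsWithin_challenge G n).timeLE (by omega), fun b r => ?_, fun r c d => ?_⟩
  · exact (runsWithin_commit G n b r).timeLE (by nlinarith)
  · exact (runsWithin_verify G n r c d).timeLE (by nlinarith)

end Procedures

/-! ### Correctness -/

section Correctness

open Timed

theorem negligible_const_mul_geometric (C : ℝ) : Negligible fun n => C * (1 / 2) ^ n := by
  refine Asymptotics.SuperpolynomialDecay.const_mul (fun d => ?_) C
  exact tendsto_pow_const_mul_const_pow_of_abs_lt_one d (by norm_num [abs_of_pos])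

theorem block_concat {n m : ℕ} (y : Fin n → Bits m) (i : Fin n) : block (concat y) i = y i := by
  funext j
  simp only [block, concat, Equiv.symm_apply_apply]

/-- The law of the comparison of two evaluations of `C` on the same uniformly random seed. -/
def agreePMF {m n : ℕ} (C : Circuit m n) : PMF Bool :=
  (PMF.uniformOfFintype (Bits m)).bind fun k => (C.outDist k).bind fun y =>
    (C.outDist k).map fun g => decide (y = g)

theorem agreePMF_false_le {m n : ℕ} (C : Circuit m n) {δ : ℝ} (hδ : 0 ≤ δ) {K : Finset (Bits m)}
    (hK : 1 - δ ≤ (#K : ℝ) / 2 ^ m)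
    (hdet : ∀ k ∈ K, ∃ y, 1 - δ ≤ (C.outDist k y).toReal) :
    (agreePMF C).toOuterMeasure {false} ≤ ENNReal.ofReal (3 * δ) := by
  have hseed : (PMF.uniformOfFintype (Bits m)).toOuterMeasure (↑K)ᶜ ≤ ENNReal.ofReal δ := by
    rw [toOuterMeasure_compl_le_ofReal_iff _ _ hδ, PMF.toOuterMeasure_uniformOfFintype_apply]
    simpa using hK
  have hdiffer (k) (hk : k ∈ K) : ((C.outDist k).bind fun y =>
      (C.outDist k).map fun g => decide (y = g)).toOuterMeasure {false} ≤
        ENNReal.ofReal δ + ENNReal.ofReal δ := by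
    obtain ⟨y₀, hy₀⟩ := hdet k hk
    have hother : (C.outDist k).toOuterMeasure {y₀}ᶜ ≤ ENNReal.ofReal δ := by
      rwa [toOuterMeasure_compl_le_ofReal_iff _ _ hδ, PMF.toOuterMeasure_apply_singleton]
    refine (toOuterMeasure_bind_le_add _ _ fun y hy => ?_).trans (add_le_add_left hother _)
    obtain rfl : y = y₀ := not_not.mp hy
    rw [PMF.toOuterMeasure_map_apply]
    refine le_trans (MeasureTheory.measure_mono fun g hg => ?_) hother
    simpa [eq_comm] using hg
  calc (agreePMF C).toOuterMeasure {false}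
      ≤ ENNReal.ofReal δ + (ENNReal.ofReal δ + ENNReal.ofReal δ) :=
        (toOuterMeasure_bind_le_add _ _ fun k hk => hdiffer k (by simpa using hk)).trans
          (add_le_add_left hseed _)
    _ = ENNReal.ofReal (3 * δ) := by
      rw [← ENNReal.ofReal_add hδ hδ, ← ENNReal.ofReal_add hδ (by positivity)]
      ring_nf

theorem matchPMF_maskBits {m n : ℕ} (C : Circuit m n) (b : Bool) (r y : Bits n) (k : Bits m) :
    matchPMF C b r (maskBits b r y) k = (C.outDist k).map fun g => decide (y = g) := by
  simp only [matchPMF, (maskBits_involutive b r).injective.eq_iff]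

theorem honestExp_naorCommitment (G : ∀ n, Circuit n (3 * n)) (n : ℕ) (b : Bool) :
    (naorCommitment G).honestExp n b =
      (productPMF fun _ : Fin n => agreePMF (G n)).map (verdict b) := by
  change (((naorCommitment G).challenge n).dist.bind fun r =>
    ((naorCommitment G).commit n b r).dist.bind fun cd =>
      ((naorCommitment G).verify n r cd.1 cd.2).dist) = _
  have hround (r : Bits (3 * n)) : (((naorCommitment G).commit n b r).dist.bind fun cd =>
      ((naorCommitment G).verify n r cd.1 cd.2).dist) =
        (productPMF fun _ : Fin n => agreePMF (G n)).map (verdict b) := by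
    simp only [(runsWithin_commit G n b r).dist_eq, ← productPMF_map, PMF.bind_bind, PMF.bind_map,
      Function.comp_def]
    simp only [(runsWithin_verify G n r _ _).dist_eq, block_concat, matchPMF_maskBits, agreePMF,
      ← productPMF_bind, productPMF_uniform, PMF.map_bind]
  exact (congrArg _ (funext hround)).trans (PMF.bind_const _ _)

theorem honestExp_naorCommitment_ge (G : ∀ n, Circuit n (3 * n)) {n : ℕ}
    (hagree : (agreePMF (G n)).toOuterMeasure {false} ≤ 64⁻¹) (b : Bool) :
    1 - (1 / 2) ^ n ≤ ((naorCommitment G).honestExp n b (some b)).toReal := by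
  have hreject : verdict b ⁻¹' {some b}ᶜ ⊆
      {e : Bits n | n ≤ 3 * #{i | e i ∈ ({false} : Set Bool)}} := by
    intro e he
    have hsplit := Finset.card_filter_add_card_filter_not (s := Finset.univ) fun i => e i = true
    simp only [verdict, Set.mem_preimage, Set.mem_compl_iff, Set.mem_singleton_iff,
      ite_eq_left_iff, reduceCtorEq, imp_false, not_not, Bool.not_eq_true, Finset.card_univ,
      Fintype.card_fin] at he hsplit
    simp only [Set.mem_singleton_iff, Set.mem_ofPred_eq]
    omega
  rw [honestExp_naorCommitment, ← PMF.toOuterMeasure_apply_singleton,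
    ← toOuterMeasure_compl_le_ofReal_iff _ _ (by positivity), PMF.toOuterMeasure_map_apply]
  refine (MeasureTheory.measure_mono hreject).trans ?_
  have htail := productPMF_third_le (fun _ : Fin n => agreePMF (G n)) (fun _ => {false})
    fun _ => hagree
  rw [Fintype.card_fin] at htail
  refine htail.trans_eq ?_
  rw [ENNReal.ofReal_pow (by norm_num), one_div, ENNReal.ofReal_inv_of_pos two_pos,
    ENNReal.ofReal_ofNat]

theorem correct_naorCommitment (G : ∀ n, Circuit n (3 * n)) {μ : ℕ → ℝ}
    (hG : Pseudodeterministic G μ) (hμ : ∀ᶠ n in atTop, μ n ≤ 1 / 192) :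
    (naorCommitment G).Correct := by
  refine ⟨fun n => if μ n ≤ 1 / 192 then (1 / 2) ^ n else 1, ?_, fun n b => ?_⟩
  · refine (negligible_const_mul_geometric 1).congr' ?_
    filter_upwards [hμ] with n hn
    rw [if_pos hn, one_mul]
  · dsimp only
    split_ifs with hn
    · obtain ⟨K, hK, hdet⟩ := hG n
      refine honestExp_naorCommitment_ge G ?_ b
      refine (agreePMF_false_le (G n) (δ := 1 / 192) (by norm_num) (hK.trans' (by linarith))
        fun k hk => (hdet k hk).imp fun y hy => hy.trans' (by linarith)).trans_eq ?_
      norm_num [ENNReal.ofReal_div_of_pos]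
    · rw [sub_self]
      exact ENNReal.toReal_nonneg

end Correctness

/-! ### Statistical binding -/

section Binding

variable {m n : ℕ}

/-- The seeds `k` and outputs `y` of `C` such that `y` has probability more than `t` given `k`. -/
def heavyPairs (C : Circuit m n) (t : ℝ≥0∞) : Finset (Bits m × Bits n) :=
  {p | t < C.outDist p.1 p.2}

theorem card_heavyPairs_mul_le (C : Circuit m n) (t : ℝ≥0∞) :
    (#(heavyPairs C t) : ℝ≥0∞) * t ≤ 2 ^ m :=
  calc (#(heavyPairs C t) : ℝ≥0∞) * t = ∑ _ ∈ heavyPairs C t, t := by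
        rw [Finset.sum_const, nsmul_eq_mul]
    _ ≤ ∑ p ∈ heavyPairs C t, C.outDist p.1 p.2 :=
        Finset.sum_le_sum fun p hp => (Finset.mem_filter.mp hp).2.le
    _ ≤ ∑ p : Bits m × Bits n, C.outDist p.1 p.2 :=
        Finset.sum_le_sum_of_subset (Finset.subset_univ _)
    _ = ∑ k, ∑ y, C.outDist k y := Fintype.sum_prod_type _
    _ = 2 ^ m := by
        simp only [sum_apply_eq_one, Finset.sum_const, Finset.card_univ, Fintype.card_fun,
          Fintype.card_bool, Fintype.card_fin, nsmul_one, Nat.cast_pow, Nat.cast_ofNat]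

/-- The receiver's messages `r` for which some block opens to both bits, under suitable seeds, with
probability more than `t`. -/
def badChallenges (C : Circuit m n) (t : ℝ≥0∞) : Set (Bits n) :=
  {r | ∃ k k' y, t < C.outDist k y * C.outDist k' (maskBits true r y)}

/-- Both factors of a product of probabilities that exceeds `t` exceed `t`, so a bad message is the
exclusive or of two heavy outputs. -/
theorem badChallenges_subset (C : Circuit m n) (t : ℝ≥0∞) :
    badChallenges C t ⊆
      ((heavyPairs C t ×ˢ heavyPairs C t).image fun p => maskBits true p.1.2 p.2.2) := by
  rintro r ⟨k, k', y, h⟩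
  have hfst : t < C.outDist k y := h.trans_le (mul_le_of_le_one_right' (PMF.coe_le_one _ _))
  have hsnd : t < C.outDist k' (maskBits true r y) :=
    h.trans_le (mul_le_of_le_one_left' (PMF.coe_le_one _ _))
  refine Finset.mem_image.mpr ⟨((k, y), (k', maskBits true r y)), ?_, ?_⟩
  · simpa only [heavyPairs, Finset.mem_product, Finset.mem_filter_univ] using ⟨hfst, hsnd⟩
  · funext j
    simp [maskBits, Bool.xor_left_comm]

theorem toOuterMeasure_badChallenges_le (C : Circuit m n) {t : ℝ≥0∞} (ht : t ≠ 0) (ht' : t ≠ ∞) :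
    (PMF.uniformOfFintype (Bits n)).toOuterMeasure (badChallenges C t) ≤
      (2 ^ m / t) ^ 2 / 2 ^ n := by
  have hheavy : (#(heavyPairs C t) : ℝ≥0∞) ≤ 2 ^ m / t :=
    (ENNReal.le_div_iff_mul_le (.inl ht) (.inl ht')).mpr (card_heavyPairs_mul_le C t)
  refine (MeasureTheory.measure_mono (badChallenges_subset C t)).trans ?_
  rw [PMF.toOuterMeasure_uniformOfFintype_apply]
  simp only [Finset.coe_sort_coe, Fintype.card_coe, Fintype.card_fun, Fintype.card_bool,
    Fintype.card_fin, Nat.cast_pow, Nat.cast_ofNat]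
  gcongr
  calc ((#((heavyPairs C t ×ˢ heavyPairs C t).image
        fun p => maskBits true p.1.2 p.2.2) : ℕ) : ℝ≥0∞)
      ≤ ((#(heavyPairs C t) * #(heavyPairs C t) : ℕ) : ℝ≥0∞) := by
        exact_mod_cast Finset.card_image_le.trans (Finset.card_product _ _).le
    _ ≤ (2 ^ m / t) ^ 2 := by
        rw [Nat.cast_mul, ← pow_two]
        gcongr

theorem matchPMF_apply_true (C : Circuit m n) (b : Bool) (r y : Bits n) (k : Bits m) :
    matchPMF C b r y k true = C.outDist k (maskBits b r y) := by
  have hpreimage : (fun g => decide (y = maskBits b r g)) ⁻¹' {true} = {maskBits b r y} := by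
    ext g
    simp only [Set.mem_preimage, Set.mem_singleton_iff, decide_eq_true_eq]
    rw [eq_comm, (maskBits_involutive b r).eq_iff, eq_comm]
  rw [← PMF.toOuterMeasure_apply_singleton, matchPMF, PMF.toOuterMeasure_map_apply, hpreimage,
    PMF.toOuterMeasure_apply_singleton]

theorem toOuterMeasure_bind_map_mk {α β : Type*} (μ : PMF α) (ν : PMF β) (a : α) (b : β) :
    (μ.bind fun x => ν.map (Prod.mk x)).toOuterMeasure {(a, b)} = μ a * ν b := by
  have hdiag : (ν.map (Prod.mk a)) (a, b) = ν b := by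
    rw [← PMF.toOuterMeasure_apply_singleton, ← PMF.toOuterMeasure_apply_singleton,
      PMF.toOuterMeasure_map_apply]
    congr 1
    ext y
    simp
  have hoff (x : α) (hx : x ≠ a) : μ x * (ν.map (Prod.mk x)) (a, b) = 0 := by
    rw [(PMF.apply_eq_zero_iff (ν.map (Prod.mk x)) (a, b)).mpr (by simp [hx]), mul_zero]
  rw [PMF.toOuterMeasure_apply_singleton, PMF.bind_apply, tsum_eq_single a hoff, hdiag]

theorem verdict_eq_some_iff {b b' : Bool} {e : Bits n} :
    verdict b e = some b' ↔ b = b' ∧ 2 * n ≤ 3 * #{i | e i = true} := by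
  simp only [verdict, Option.ite_none_right_eq_some, Option.some.injEq, and_comm]

/-- Two sets of at least two thirds of the indices have at least a third of them in common. -/
theorem third_le_of_verdict_eq_some {b b' c c' : Bool} {v : Fin n → Bool × Bool}
    (h : verdict b (fun i => (v i).1) = some c) (h' : verdict b' (fun i => (v i).2) = some c') :
    n ≤ 3 * #{i | v i ∈ ({(true, true)} : Set (Bool × Bool))} := by
  let s : Finset (Fin n) := {i | (v i).1 = true}
  let s' : Finset (Fin n) := {i | (v i).2 = true}
  have hs : 2 * n ≤ 3 * #s := (verdict_eq_some_iff.mp h).2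
  have hs' : 2 * n ≤ 3 * #s' := (verdict_eq_some_iff.mp h').2
  have hunion : #(s ∪ s') ≤ n := (Finset.card_le_univ _).trans_eq (Fintype.card_fin n)
  have hinter :
      s ∩ s' = ({i | v i ∈ ({(true, true)} : Set (Bool × Bool))} : Finset (Fin n)) := by
    simp only [s, s', ← Finset.filter_and, Set.mem_singleton_iff, Prod.ext_iff]
  have hcard := Finset.card_union_add_card_inter s s'
  rw [← hinter]
  omega

theorem doubleVerify_dist_eq (G : ∀ n, Circuit n (3 * n)) {n : ℕ} (r : Bits (3 * n))
    (c : Bits (n * (3 * n))) (d d' : Bool × (Fin n → Bits n)) :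
    (((naorCommitment G).verify n r c d).dist.bind fun v =>
      ((naorCommitment G).verify n r c d').dist.bind fun v' =>
        PMF.pure (decide (v = some false) && decide (v' = some true))) =
      (productPMF fun i => (matchPMF (G n) d.1 r (block c i) (d.2 i)).bind fun e =>
        (matchPMF (G n) d'.1 r (block c i) (d'.2 i)).map (Prod.mk e)).map fun v =>
          decide (verdict d.1 (fun i => (v i).1) = some false) &&
            decide (verdict d'.1 (fun i => (v i).2) = some true) := by
  simp only [(runsWithin_verify G n r c _).dist_eq, ← productPMF_pair, PMF.map_bind,
    PMF.bind_map, PMF.map_comp, Function.comp_def]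
  simp only [← PMF.bind_pure_comp, Function.comp_def]

theorem toOuterMeasure_doubleVerify_le (G : ∀ n, Circuit n (3 * n)) {n : ℕ} {r : Bits (3 * n)}
    (hr : r ∉ badChallenges (G n) 64⁻¹) (c : Bits (n * (3 * n)))
    (d d' : Bool × (Fin n → Bits n)) :
    (((naorCommitment G).verify n r c d).dist.bind fun v =>
      ((naorCommitment G).verify n r c d').dist.bind fun v' =>
        PMF.pure (decide (v = some false) && decide (v' = some true))).toOuterMeasure {true} ≤
      2⁻¹ ^ n := by
  rw [doubleVerify_dist_eq, PMF.toOuterMeasure_map_apply]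
  set event := (fun v : Fin n → Bool × Bool =>
    decide (verdict d.1 (fun i => (v i).1) = some false) &&
      decide (verdict d'.1 (fun i => (v i).2) = some true)) ⁻¹' {true}
  have haccept {v} (hv : v ∈ event) : verdict d.1 (fun i => (v i).1) = some false ∧
      verdict d'.1 (fun i => (v i).2) = some true := by
    simpa only [event, Set.mem_preimage, Set.mem_singleton_iff, Bool.and_eq_true,
      decide_eq_true_eq] using hv
  by_cases hb : d.1 = false ∧ d'.1 = true
  · have hevent : event ⊆ {v | n ≤ 3 * #{i | v i ∈ ({(true, true)} : Set (Bool × Bool))}} :=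
      fun v hv => third_le_of_verdict_eq_some (haccept hv).1 (haccept hv).2
    have hpair (i : Fin n) : ((matchPMF (G n) d.1 r (block c i) (d.2 i)).bind fun e =>
        (matchPMF (G n) d'.1 r (block c i) (d'.2 i)).map (Prod.mk e)).toOuterMeasure
          {(true, true)} ≤ 64⁻¹ := by
      rw [hb.1, hb.2, toOuterMeasure_bind_map_mk, matchPMF_apply_true, matchPMF_apply_true]
      exact not_lt.mp fun h => hr ⟨d.2 i, d'.2 i, block c i, h⟩
    refine (MeasureTheory.measure_mono hevent).trans ?_
    simpa only [Fintype.card_fin] using productPMF_third_le _ (fun _ => {(true, true)}) hpair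
  · have hempty : event = ∅ := Set.eq_empty_of_forall_notMem fun v hv =>
      hb ⟨(verdict_eq_some_iff.mp (haccept hv).1).1, (verdict_eq_some_iff.mp (haccept hv).2).1⟩
    rw [hempty, MeasureTheory.measure_empty]
    exact zero_le

theorem statisticallyBinding_naorCommitment (G : ∀ n, Circuit n (3 * n)) :
    (naorCommitment G).StatisticallyBinding := by
  refine ⟨fun n => 4097 * (1 / 2) ^ n, negligible_const_mul_geometric 4097, fun n C => ?_⟩
  have hbad : (PMF.uniformOfFintype (Bits (3 * n))).toOuterMeasure (badChallenges (G n) 64⁻¹) ≤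
      4096 * 2⁻¹ ^ n := by
    refine (toOuterMeasure_badChallenges_le (G n) (by simp) (by simp)).trans_eq ?_
    have h2 : (2 : ℝ≥0∞) ^ (3 * n) = (2 ^ n) ^ 2 * 2 ^ n := by ring
    rw [div_eq_mul_inv, div_eq_mul_inv, inv_inv, h2, ENNReal.mul_inv (by simp) (by simp), mul_pow,
      ← ENNReal.inv_pow, mul_comm (_ ^ 2), mul_assoc, ← mul_assoc ((2 ^ n) ^ 2),
      ENNReal.mul_inv_cancel (by simp) (by simp), one_mul]
    norm_num
  have hcheat : ((naorCommitment G).bindingExp n C).toOuterMeasure {true} ≤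
      4097 * 2⁻¹ ^ n := by
    rw [show (4097 : ℝ≥0∞) = 4096 + 1 by norm_num, add_one_mul]
    change ((((naorCommitment G).challenge n).dist.bind _).toOuterMeasure _ ≤ _)
    rw [(runsWithin_challenge G n).dist_eq]
    refine (toOuterMeasure_bind_le_add _ _ fun r hr => ?_).trans (add_le_add_left hbad _)
    exact toOuterMeasure_bind_le _ _ fun ⟨c, d₀, d₁⟩ =>
      toOuterMeasure_doubleVerify_le G hr c d₀ d₁
  rw [PMF.toOuterMeasure_apply_singleton] at hcheat
  refine (ENNReal.toReal_mono (by finiteness) hcheat).trans_eq ?_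
  simp

end Binding

/-! ### Hardwiring classical bits into a circuit -/

section Hardwiring

/-- The linear map `|u⟩ ↦ |φ u⟩` between spaces with bases indexed by `α` and `β`. -/
def basisMap {α β : Type*} [DecidableEq β] (φ : α → β) : Matrix β α ℂ :=
  Matrix.of fun x u => if x = φ u then 1 else 0

theorem basisMap_mul_basisMap {α β γ : Type*} [Fintype β] [DecidableEq β] [DecidableEq γ]
    (φ : β → γ) (ψ : α → β) : basisMap φ * basisMap ψ = basisMap (φ ∘ ψ) := by
  ext x u
  simp [basisMap, Matrix.mul_apply]

theorem basisMap_id {α : Type*} [DecidableEq α] : basisMap (id : α → α) = 1 := by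
  ext x u
  simp [basisMap, Matrix.one_apply]

/-- The operator `∑ u v, σ u v • |φ u⟩⟨φ v|`. -/
def relabel {m n : ℕ} (φ : Bits m → Bits n) (σ : Op m) : Op n := basisMap φ * σ * (basisMap φ)ᴴ

theorem relabel_relabel {l m n : ℕ} (φ : Bits m → Bits n) (ψ : Bits l → Bits m) (σ : Op l) :
    relabel φ (relabel ψ σ) = relabel (φ ∘ ψ) σ := by
  simp only [relabel, ← basisMap_mul_basisMap, Matrix.conjTranspose_mul, Matrix.mul_assoc]

theorem basisMap_mul_apply {α β γ : Type*} [Fintype α] [DecidableEq β] (φ : α ≃ β)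
    (M : Matrix α γ ℂ) (x : β) (v : γ) : (basisMap φ * M) x v = M (φ.symm x) v := by
  classical
  simp [basisMap, Matrix.mul_apply, ← Equiv.symm_apply_eq]

variable {w : ℕ}

/-- The unitary of a list of gates, of which the head acts first. -/
def gatesMat (l : List (Gate w)) : Op w := l.foldl (fun U g => g.mat * U) 1

theorem foldl_mat_mul (l : List (Gate w)) (U : Op w) :
    l.foldl (fun U g => g.mat * U) U = gatesMat l * U := by
  induction l generalizing U with
  | nil => simp [gatesMat]
  | cons g l ih =>
    rw [gatesMat, List.foldl_cons, List.foldl_cons, ih, ih (g.mat * 1), Matrix.mul_one,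
      Matrix.mul_assoc]

theorem gatesMat_append (l l' : List (Gate w)) :
    gatesMat (l ++ l') = gatesMat l' * gatesMat l := by
  rw [gatesMat, List.foldl_append, foldl_mat_mul]
  rfl

/-- The bit flip of wire `i`. -/
def flipBit (i : Fin w) (x : Bits w) : Bits w := Function.update x i (!x i)

theorem flipBit_involutive (i : Fin w) : Function.Involutive (flipBit i) := fun x => by
  simp [flipBit]

/-- The gate sequence `H T⁴ H = H Z H`, which is the bit flip of wire `i`. -/
def notGates (i : Fin w) : List (Gate w) := [.H i, .T i, .T i, .T i, .T i, .H i]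

theorem mat_T_pow_four (i : Fin w) :
    (Gate.T i).mat ^ 4 = Matrix.diagonal fun x => if x i then -1 else 1 := by
  rw [Gate.mat, Matrix.diagonal_pow]
  congr 1
  funext x
  have hphase : Complex.exp ((Real.pi / 4 : ℝ) * Complex.I) ^ 4 = -1 := by
    rw [← Complex.exp_nat_mul, ← Complex.exp_pi_mul_I]
    congr 1
    push_cast
    ring
  by_cases hx : x i <;> simp only [Pi.pow_apply, hx, if_true, if_false, hphase, one_pow,
    Bool.false_eq_true]

theorem mat_H_mul_phaseFlip (i : Fin w) :
    (Gate.H i).mat * Matrix.diagonal (fun x => if x i then -1 else 1) =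
      basisMap (flipBit i) * (Gate.H i).mat := by
  ext x y
  have hflip : (∀ j, j ≠ i → flipBit i x j = y j) ↔ ∀ j, j ≠ i → x j = y j :=
    forall₂_congr fun j hj => by rw [flipBit, Function.update_of_ne hj]
  rw [Matrix.mul_diagonal]
  refine Eq.trans ?_ (basisMap_mul_apply (flipBit_involutive i).toPerm _ x y).symm
  simp only [Gate.mat, Matrix.of_apply, Function.Involutive.toPerm_symm,
    Function.Involutive.coe_toPerm, hflip]
  simp only [flipBit, Function.update_self]
  split_ifs <;> simp_all

theorem mat_H_mul_mat_H (i : Fin w) : (Gate.H i).mat * (Gate.H i).mat = 1 := by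
  have hself : (Gate.H i).matᴴ = (Gate.H i).mat := by
    ext x y
    simp only [Gate.mat, Matrix.conjTranspose_apply, Matrix.of_apply, apply_ite star, star_zero,
      star_mul', star_neg, star_one, Complex.star_def, Complex.conj_ofReal]
    simp only [eq_comm (a := y _), Bool.and_comm]
  simpa only [hself] using (Gate.H i).mat_unitary

theorem gatesMat_notGates (i : Fin w) : gatesMat (notGates i) = basisMap (flipBit i) :=
  calc gatesMat (notGates i)
      = (Gate.H i).mat * (Gate.T i).mat ^ 4 * (Gate.H i).mat := by
        simp only [gatesMat, notGates, List.foldl_cons, List.foldl_nil, Matrix.mul_one, pow_succ,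
          pow_zero, Matrix.one_mul, Matrix.mul_assoc]
    _ = basisMap (flipBit i) := by
        rw [mat_T_pow_four, mat_H_mul_phaseFlip, Matrix.mul_assoc, mat_H_mul_mat_H, Matrix.mul_one]

/-- Gates that compute the bitwise exclusive or with the constant string `z`. -/
def xorGates (z : Bits w) : List (Gate w) :=
  (List.finRange w).flatMap fun i => if z i then notGates i else []

theorem length_xorGates_le (z : Bits w) : (xorGates z).length ≤ 6 * w := by
  have hblock (i : Fin w) : (if z i then notGates i else []).length ≤ 6 := by
    split_ifs <;> simp [notGates]
  calc (xorGates z).length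
      = ((List.finRange w).map fun i => (if z i then notGates i else []).length).sum :=
        List.length_flatMap
    _ ≤ ((List.finRange w).map fun _ => 6).sum := List.sum_le_sum fun i _ => hblock i
    _ = 6 * w := by simp [mul_comm]

theorem gatesMat_xorGates (z : Bits w) :
    gatesMat (xorGates z) = basisMap fun x j => xor (z j) (x j) := by
  have hlist (l : List (Fin w)) (hl : l.Nodup) :
      gatesMat (l.flatMap fun i => if z i then notGates i else []) =
        basisMap fun x j => xor (decide (j ∈ l) && z j) (x j) := by
    induction l with
    | nil =>
      simp only [List.not_mem_nil, decide_false, Bool.false_and, Bool.false_xor]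
      exact basisMap_id.symm
    | cons i l ih =>
      have hhead : gatesMat (if z i then notGates i else []) =
          basisMap fun x => Function.update x i (xor (z i) (x i)) := by
        cases hz : z i
        · simp only [Bool.false_xor, Function.update_eq_self]
          exact basisMap_id.symm
        · simp only [if_true, Bool.true_xor]
          exact gatesMat_notGates i
      rw [List.flatMap_cons, gatesMat_append, ih hl.of_cons, hhead, basisMap_mul_basisMap]
      congr 1
      funext x j
      by_cases hj : j = i
      · subst hj
        simp [(List.nodup_cons.mp hl).1]
      · simp [hj]
  simpa [xorGates] using hlist (List.finRange w) (List.nodup_finRange w)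

variable {m m' n : ℕ}

/-- The circuit that feeds the input `x ↦ z ⊕ (x along g)` to `C`: the input wires of `C` outside
the range of `g` are set to the constants `z`, and the others are masked by `z`. -/
def Circuit.hardwire (C : Circuit m n) (g : Fin m' ↪ Fin m) (z : Bits m) : Circuit m' n where
  wires := C.wires
  inp := g.trans C.inp
  out := C.out
  gates := xorGates (Function.extend C.inp z fun _ => false) ++ C.gates

/-- The input that `Circuit.hardwire` feeds to the given circuit. -/
def hardwiredInput (g : Fin m' ↪ Fin m) (z : Bits m) (u : Bits m') : Bits m := fun j =>
  xor (z j) (Function.extend g u (fun _ => false) j)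

theorem extend_xor_extend (f : Fin m ↪ Fin w) (g : Fin m' ↪ Fin m) (z : Bits m) (u : Bits m') :
    (fun j => xor (Function.extend f z (fun _ => false) j)
      (Function.extend (g.trans f) u (fun _ => false) j)) =
        Function.extend f (hardwiredInput g z u) fun _ => false := by
  funext j
  by_cases hj : ∃ i, f i = j
  · obtain ⟨i, rfl⟩ := hj
    have hcomp : Function.extend (g.trans f) u (fun _ => false) (f i) =
        Function.extend g u (fun _ => false) i := by
      by_cases hi : ∃ k, g k = i
      · obtain ⟨k, rfl⟩ := hi
        exact ((g.trans f).injective.extend_apply _ _ k).trans (g.injective.extend_apply _ _ k).symm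
      · rw [Function.extend_apply' _ _ _ hi, Function.extend_apply']
        exact fun ⟨k, hk⟩ => hi ⟨k, f.injective hk⟩
    rw [f.injective.extend_apply, f.injective.extend_apply, hcomp, hardwiredInput]
  · have hj' : ¬∃ k, (g.trans f) k = j := fun ⟨k, hk⟩ => hj ⟨g k, hk⟩
    rw [Function.extend_apply' _ _ _ hj, Function.extend_apply' _ _ _ hj,
      Function.extend_apply' _ _ _ hj', Bool.false_xor]

theorem Circuit.unitary_mul_initIso_hardwire (C : Circuit m n) (g : Fin m' ↪ Fin m) (z : Bits m) :
    ((C.hardwire g z).unitary * (C.hardwire g z).initIso : Matrix (Bits C.wires) (Bits m') ℂ) =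
      C.unitary * C.initIso * basisMap (hardwiredInput g z) := by
  have hfeed : ((fun x j => xor (Function.extend C.inp z (fun _ => false) j) (x j)) ∘
      fun u => Function.extend (g.trans C.inp) u fun _ => false) =
        (fun v => Function.extend C.inp v fun _ => false) ∘ hardwiredInput g z :=
    funext fun u => extend_xor_extend C.inp g z u
  change gatesMat (xorGates (Function.extend C.inp z fun _ => false) ++ C.gates) *
      basisMap (fun u => Function.extend (g.trans C.inp) u fun _ => false) =
    gatesMat C.gates * basisMap (fun v => Function.extend C.inp v fun _ => false) * basisMap _
  rw [gatesMat_append, gatesMat_xorGates, Matrix.mul_assoc, Matrix.mul_assoc,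
    basisMap_mul_basisMap, basisMap_mul_basisMap, hfeed]

theorem Circuit.run_hardwire (C : Circuit m n) (g : Fin m' ↪ Fin m) (z : Bits m) (ρ : Op m') :
    (C.hardwire g z).run ρ = C.run (relabel (hardwiredInput g z) ρ) := by
  refine (congrArg (fun V : Matrix (Bits C.wires) (Bits m') ℂ => C.traceOut (V * ρ * Vᴴ))
    (C.unitary_mul_initIso_hardwire g z)).trans ?_
  rw [Circuit.run, relabel, Matrix.conjTranspose_mul]
  simp only [Matrix.mul_assoc]

theorem Circuit.size_hardwire_le (C : Circuit m n) (g : Fin m' ↪ Fin m) (z : Bits m) :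
    (C.hardwire g z).size ≤ 7 * C.size := by
  have hxor := length_xorGates_le (Function.extend C.inp z fun _ => false)
  simp only [Circuit.size, Circuit.hardwire, List.length_append]
  omega

end Hardwiring

/-! ### States and channels -/

section States

variable {m n s w : ℕ}

/-- The Kraus operators of the partial trace, indexed by the values `z` of the discarded bits. -/
def traceKraus (out : Fin n ↪ Fin w) (z : {j // j ∉ Set.range out} → Bool) :
    Matrix (Bits n) (Bits w) ℂ :=
  Matrix.of fun u x => if (∀ i, x (out i) = u i) ∧ (fun j : {j // j ∉ Set.range out} => x j) = z
    then 1 else 0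

theorem sum_traceKraus_mul (out : Fin n ↪ Fin w) (u v : Bits n) (x y : Bits w) :
    ∑ z, traceKraus out z u x * star (traceKraus out z v y) =
      if (∀ i, x (out i) = u i) ∧ (∀ i, y (out i) = v i) ∧
        (∀ j, j ∉ Set.range out → x j = y j) then 1 else 0 := by
  have hrestrict : (∀ j, j ∉ Set.range out → x j = y j) ↔
      (fun j : {j // j ∉ Set.range out} => y j) = fun j : {j // j ∉ Set.range out} => x j := by
    simp only [funext_iff, Subtype.forall, eq_comm]
  simp only [traceKraus, Matrix.of_apply, apply_ite star, star_one, star_zero, ite_and,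
    ite_mul, one_mul, zero_mul, Finset.sum_ite_irrel, Finset.sum_const_zero, Finset.sum_ite_eq,
    Finset.mem_univ, if_true, hrestrict]

theorem Circuit.traceOut_eq_sum (C : Circuit m n) (σ : Op C.wires) :
    C.traceOut σ = ∑ z, traceKraus C.out z * σ * (traceKraus C.out z)ᴴ := by
  ext u v
  simp only [Circuit.traceOut, Matrix.of_apply, Matrix.sum_apply, Matrix.mul_apply,
    Matrix.conjTranspose_apply, Finset.sum_mul]
  refine Eq.symm <| Finset.sum_comm_cycle.trans <| Finset.sum_congr rfl fun x _ =>
    Finset.sum_comm.trans <| Finset.sum_congr rfl fun y _ => Eq.symm ?_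
  calc (if _ then σ x y else 0)
      = σ x y * ∑ z, traceKraus C.out z u x * star (traceKraus C.out z v y) := by
        rw [sum_traceKraus_mul, mul_ite, mul_one, mul_zero]
    _ = ∑ z, traceKraus C.out z u x * σ x y * star (traceKraus C.out z v y) := by
        rw [Finset.mul_sum]
        exact Finset.sum_congr rfl fun z _ => by ring

theorem Circuit.run_eq_sum (C : Circuit m n) (ρ : Op m) :
    C.run ρ = ∑ z, (traceKraus C.out z * (C.unitary * C.initIso)) * ρ *
      (traceKraus C.out z * (C.unitary * C.initIso))ᴴ := by
  simp only [Circuit.run, Circuit.traceOut_eq_sum, Matrix.conjTranspose_mul, Matrix.mul_assoc]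

theorem Circuit.run_isDensity (C : Circuit m n) {ρ : Op m} (hρ : IsDensity ρ) :
    IsDensity (C.run ρ) := by
  refine ⟨?_, (C.run_diag_sum ρ).trans hρ.2⟩
  rw [C.run_eq_sum]
  exact Matrix.posSemidef_sum _ fun z _ => hρ.1.mul_mul_conjTranspose_same _

theorem sum_append {M : Type*} [AddCommMonoid M] (f : Bits (m + n) → M) :
    ∑ x, f x = ∑ u, ∑ v, f (Fin.append u v) := by
  rw [← Fintype.sum_prod_type']
  exact ((Fin.appendEquiv m n).sum_comp f).symm

theorem tensor_append (ρ : Op m) (σ : Op n) (x x' : Bits m) (y y' : Bits n) :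
    tensor ρ σ (Fin.append x y) (Fin.append x' y') = ρ x x' * σ y y' := by
  simp only [tensor, Matrix.of_apply, Fin.append_left, Fin.append_right]

theorem IsDensity.tensor {ρ : Op m} {σ : Op n} (hρ : IsDensity ρ) (hσ : IsDensity σ) :
    IsDensity (tensor ρ σ) := by
  refine ⟨(hρ.1.kronecker hσ.1).submatrix fun x : Bits (m + n) =>
    ((fun i => x (Fin.castAdd n i) : Bits m), (fun j => x (Fin.natAdd m j) : Bits n)), ?_⟩
  calc (QCommit.tensor ρ σ).trace = ∑ u, ∑ v, ρ u u * σ v v := by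
        simp only [Matrix.trace, Matrix.diag_apply, sum_append, tensor_append]
    _ = ρ.trace * σ.trace := (Finset.sum_mul_sum _ _ _ _).symm
    _ = 1 := by rw [hρ.2, hσ.2, one_mul]

theorem isDensity_classicalState (μ : PMF (Bits n)) : IsDensity (classicalState μ) := by
  constructor
  · exact Matrix.PosSemidef.diagonal fun y => Complex.zero_le_real.mpr ENNReal.toReal_nonneg
  · rw [classicalState, Matrix.trace_diagonal, ← Complex.ofReal_sum, sum_toReal_apply_eq_one,
      Complex.ofReal_one]

theorem isDensity_one : IsDensity (1 : Op 0) :=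
  ⟨Matrix.PosSemidef.one, by simp [Matrix.trace_one]⟩

theorem exists_isDensity_smul {ρ : Op n} (hρ : ρ.PosSemidef) :
    ∃ ρ' : Op n, IsDensity ρ' ∧ ρ = ρ.trace.re • ρ' := by
  have htrace : ρ.trace = (ρ.trace.re : ℂ) := Complex.eq_re_of_ofReal_le hρ.trace_nonneg
  by_cases hzero : ρ.trace.re = 0
  · refine ⟨classicalState (PMF.pure fun _ => false), isDensity_classicalState _, ?_⟩
    rw [hzero, zero_smul]
    exact hρ.trace_eq_zero_iff.mp (by rw [htrace, hzero, Complex.ofReal_zero])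
  · have hinv : 0 ≤ (ρ.trace.re)⁻¹ := inv_nonneg.mpr (Complex.le_def.mp hρ.trace_nonneg).1
    refine ⟨(ρ.trace.re)⁻¹ • ρ, ⟨hρ.smul hinv, ?_⟩, (smul_inv_smul₀ hzero ρ).symm⟩
    rw [Matrix.trace_smul, Complex.real_smul]
    nth_rw 2 [htrace]
    rw [← Complex.ofReal_mul, inv_mul_cancel₀ hzero, Complex.ofReal_one]

theorem outcomePart_posSemidef {σ : Op (m + s)} (hσ : σ.PosSemidef) (r : Bits m) :
    (CommitmentScheme.outcomePart σ r).PosSemidef :=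
  hσ.submatrix fun u : Bits s => Fin.append r u

theorem sum_trace_outcomePart {σ : Op (m + s)} (hσ : IsDensity σ) :
    ∑ r, (CommitmentScheme.outcomePart σ r).trace.re = 1 := by
  have htrace : ∑ r, ∑ u, σ (Fin.append r u) (Fin.append r u) = 1 :=
    (sum_append fun x => σ x x).symm.trans hσ.2
  rw [← Complex.re_sum]
  exact (congrArg Complex.re htrace).trans Complex.one_re

theorem classicalState_eq_expectation (μ : PMF (Bits n)) :
    classicalState μ = expectation μ fun x => classicalState (PMF.pure x) := by
  ext u v
  simp only [expectation, Matrix.sum_apply, Matrix.smul_apply, classicalState,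
    Matrix.diagonal_apply, PMF.pure_apply]
  by_cases h : u = v <;> simp [h, apply_ite ENNReal.toReal, apply_ite Complex.ofReal]

theorem tensor_classicalState_pure (y : Bits m) (σ : Op n) :
    tensor (classicalState (PMF.pure y)) σ = relabel (Fin.append y) σ := by
  refine Matrix.ext fun a b => ?_
  obtain ⟨⟨u, v⟩, rfl⟩ := (Fin.appendEquiv m n).surjective a
  obtain ⟨⟨u', v'⟩, rfl⟩ := (Fin.appendEquiv m n).surjective b
  have hentry (u : Bits m) (v c : Bits n) :
      basisMap (Fin.append y : Bits n → Bits (m + n)) (Fin.append u v) c =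
        if u = y then if v = c then 1 else 0 else 0 := by
    rw [← ite_and]
    refine if_congr ?_ rfl rfl
    exact (Fin.appendEquiv m n).injective.eq_iff (a := (u, v)) (b := (y, c)) |>.trans Prod.ext_iff
  simp only [Fin.appendEquiv, Equiv.coe_fn_mk, tensor_append, relabel, Matrix.mul_apply,
    Matrix.conjTranspose_apply, hentry, classicalState, Matrix.diagonal_apply, PMF.pure_apply]
  by_cases hu : u = y
  · by_cases hu' : u' = y
    · simp [hu, hu']
    · simp [hu, hu', Ne.symm hu']
  · simp [hu]

/-- Tensoring with `σ` on the right, as a linear map. -/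
def tensorRight (σ : Op n) : Op m →ₗ[ℝ] Op (m + n) where
  toFun ρ := tensor ρ σ
  map_add' ρ ρ' := by
    ext x y
    simp only [tensor, Matrix.of_apply, Matrix.add_apply, add_mul]
  map_smul' a ρ := by
    ext x y
    simp only [tensor, Matrix.of_apply, Matrix.smul_apply, smul_mul_assoc, RingHom.id_apply]

theorem tensor_smul_right (a : ℝ) (ρ : Op m) (σ : Op n) :
    tensor ρ (a • σ) = a • tensor ρ σ := by
  ext x y
  simp only [tensor, Matrix.of_apply, Matrix.smul_apply, mul_smul_comm]

end States

section Acceptance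

variable {m k : ℕ → ℕ}

theorem NonuniformQPT.run_isDensity (A : NonuniformQPT m k) (n : ℕ) {ρ : Op (m n)}
    (hρ : IsDensity ρ) : IsDensity (A.run n ρ) :=
  (A.circuit n).run_isDensity (hρ.tensor (A.advice_density n))

theorem Circuit.run_add {m n : ℕ} (C : Circuit m n) (ρ σ : Op m) :
    C.run (ρ + σ) = C.run ρ + C.run σ := by
  simp only [C.run_eq_sum, Matrix.mul_add, Matrix.add_mul, Finset.sum_add_distrib]

theorem Circuit.run_smul {m n : ℕ} (C : Circuit m n) (a : ℝ) (ρ : Op m) :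
    C.run (a • ρ) = a • C.run ρ := by
  simp only [C.run_eq_sum, Matrix.mul_smul, Matrix.smul_mul, Finset.smul_sum]

/-- The acceptance probability as a linear functional of the input state. -/
def NonuniformQPT.acceptLinear (A : NonuniformQPT m fun _ => 1) (n : ℕ) : Op (m n) →ₗ[ℝ] ℝ where
  toFun := A.accept n
  map_add' ρ σ := by
    have hadd : A.run n (ρ + σ) = A.run n ρ + A.run n σ :=
      (congrArg _ (map_add (tensorRight (A.advice n)) ρ σ)).trans (Circuit.run_add _ _ _)
    rw [NonuniformQPT.accept, hadd]
    exact Complex.add_re _ _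
  map_smul' a ρ := by
    have hsmul : A.run n (a • ρ) = a • A.run n ρ :=
      (congrArg _ (map_smul (tensorRight (A.advice n)) a ρ)).trans (Circuit.run_smul _ _ _)
    rw [NonuniformQPT.accept, hsmul]
    exact Complex.smul_re _ _

theorem NonuniformQPT.accept_classicalState (A : NonuniformQPT m fun _ => 1) (n : ℕ)
    (μ : PMF (Bits (m n))) :
    A.accept n (classicalState μ) =
      expectation μ fun x => A.accept n (classicalState (PMF.pure x)) := by
  rw [classicalState_eq_expectation]
  exact map_expectation (A.acceptLinear n) μ _

theorem NonuniformQPT.accept_tensor_classicalState {c s : ℕ → ℕ}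
    (D : NonuniformQPT (fun n => c n + s n) fun _ => 1) (n : ℕ) (μ : PMF (Bits (c n)))
    (ρ : Op (s n)) :
    D.accept n (tensor (classicalState μ) ρ) =
      expectation μ fun x => D.accept n (tensor (classicalState (PMF.pure x)) ρ) := by
  rw [classicalState_eq_expectation]
  exact map_expectation (D.acceptLinear n ∘ₗ tensorRight ρ) μ _

end Acceptance

/-! ### Hardwired input bits -/

section Assoc

variable {l m n m' : ℕ}

theorem relabel_equiv_apply (e : Bits m ≃ Bits n) (σ : Op m) (x y : Bits n) :
    relabel e σ x y = σ (e.symm x) (e.symm y) := by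
  simp [relabel, basisMap, Matrix.mul_apply, ← Equiv.symm_apply_eq]

theorem tensor_assoc (ρ : Op l) (σ : Op m) (τ : Op n) :
    tensor (tensor ρ σ) τ =
      relabel (fun x => x ∘ Fin.cast (Nat.add_assoc l m n)) (tensor ρ (tensor σ τ)) := by
  let e : Bits (l + (m + n)) ≃ Bits (l + m + n) :=
    (finCongr (Nat.add_assoc l m n)).symm.arrowCongr (Equiv.refl Bool)
  refine Matrix.ext fun x y => Eq.trans ?_ (relabel_equiv_apply e _ x y).symm
  have hlast (v : Bits (l + m + n)) :
      (fun j => e.symm v (Fin.natAdd l (Fin.natAdd m j))) = fun j => v (Fin.natAdd (l + m) j) :=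
    funext fun j => congrArg v (Fin.ext (Nat.add_assoc l m j).symm)
  simp only [tensor, Matrix.of_apply, mul_assoc, hlast]
  rfl

/-- The embedding `e` of the first wires, together with the identity of the last `s` wires. -/
def appendWires (s : ℕ) (e : Fin m' ↪ Fin m) : Fin (m' + s) ↪ Fin (m + s) :=
  finSumFinEquiv.symm.toEmbedding.trans
    ((e.sumMap (Function.Embedding.refl (Fin s))).trans finSumFinEquiv.toEmbedding)

theorem hardwiredInput_appendWires (s : ℕ) (e : Fin m' ↪ Fin m) (z : Bits m) (u : Bits m')
    (v : Bits s) :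
    hardwiredInput (appendWires s e) (Fin.append z fun _ => false) (Fin.append u v) =
      Fin.append (hardwiredInput e z u) v := by
  have hleft (i : Fin m') : appendWires s e (Fin.castAdd s i) = Fin.castAdd s (e i) := by
    simp [appendWires]
  have hright (j : Fin s) : appendWires s e (Fin.natAdd m' j) = Fin.natAdd m j := by
    simp [appendWires]
  refine funext <| Fin.addCases (fun i => ?_) fun j => ?_
  · simp only [hardwiredInput, Fin.append_left]
    by_cases hi : ∃ k, e k = i
    · obtain ⟨k, rfl⟩ := hi
      rw [← hleft, (appendWires s e).injective.extend_apply, e.injective.extend_apply,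
        Fin.append_left]
    · rw [Function.extend_apply' _ _ _ hi, Function.extend_apply']
      rintro ⟨k, hk⟩
      revert hk
      refine Fin.addCases (fun k hk => ?_) (fun j hj => ?_) k
      · rw [hleft] at hk
        exact hi ⟨k, Fin.castAdd_injective _ _ hk⟩
      · rw [hright] at hj
        have := congrArg Fin.val hj
        simp only [Fin.val_natAdd, Fin.val_castAdd] at this
        omega
  · rw [hardwiredInput, ← hright, (appendWires s e).injective.extend_apply]
    simp [hright]

theorem hardwiredInput_trans_equiv {n : ℕ} (g : Fin m' ↪ Fin m) (e : Fin m ≃ Fin n) (z : Bits m) :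
    hardwiredInput (g.trans e.toEmbedding) (z ∘ e.symm) =
      (fun x => x ∘ e.symm) ∘ hardwiredInput g z := by
  funext u j
  obtain ⟨j, rfl⟩ := e.surjective j
  simp only [hardwiredInput, Function.comp_apply, Equiv.symm_apply_apply]
  congr 1
  by_cases hj : ∃ k, g k = j
  · obtain ⟨k, rfl⟩ := hj
    exact ((g.trans e.toEmbedding).injective.extend_apply _ _ k).trans
      (g.injective.extend_apply _ _ k).symm
  · rw [Function.extend_apply' _ _ _ hj, Function.extend_apply']
    exact fun ⟨k, hk⟩ => hj ⟨k, e.injective hk⟩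

end Assoc

section Reduction

variable {c s q : ℕ → ℕ}

/-- The algorithm that runs `D` on its input, hardwired into the first `c n` input qubits of `D`
along `e` and `z`, and on the advice state `ρ`. -/
def hardwireReduction (D : NonuniformQPT (fun n => c n + s n) fun _ => 1)
    (e : ∀ n, Fin (q n) ↪ Fin (c n)) (z : ∀ n, Bits (c n)) (ρ : ∀ n, Op (s n))
    (hρ : ∀ n, IsDensity (ρ n)) : NonuniformQPT q fun _ => 1 where
  adviceLen n := s n + D.adviceLen n
  circuit n := (D.circuit n).hardwire
    ((appendWires (s n + D.adviceLen n) (e n)).trans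
      (finCongr (Nat.add_assoc _ _ _).symm).toEmbedding)
    (Fin.append (z n) (fun _ => false) ∘ Fin.cast (Nat.add_assoc _ _ _))
  advice n := tensor (ρ n) (D.advice n)
  advice_density n := (hρ n).tensor (D.advice_density n)
  poly := by
    obtain ⟨p, hp⟩ := D.poly
    refine ⟨7 * p, fun n => (Circuit.size_hardwire_le _ _ _).trans ?_⟩
    simpa using hp n

theorem accept_hardwireReduction (D : NonuniformQPT (fun n => c n + s n) fun _ => 1)
    (e : ∀ n, Fin (q n) ↪ Fin (c n)) (z : ∀ n, Bits (c n)) (ρ : ∀ n, Op (s n))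
    (hρ : ∀ n, IsDensity (ρ n)) (n : ℕ) (y : Bits (q n)) :
    (hardwireReduction D e z ρ hρ).accept n (classicalState (PMF.pure y)) =
      D.accept n (tensor (classicalState (PMF.pure (hardwiredInput (e n) (z n) y))) (ρ n)) := by
  suffices hrun : (hardwireReduction D e z ρ hρ).run n (classicalState (PMF.pure y)) =
      D.run n (tensor (classicalState (PMF.pure (hardwiredInput (e n) (z n) y))) (ρ n)) by
    rw [NonuniformQPT.accept, hrun]
    rfl
  refine (Circuit.run_hardwire _ _ _ _).trans (congrArg (D.circuit n).run ?_)
  rw [tensor_assoc]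
  simp only [tensor_classicalState_pure, relabel_relabel]
  refine congrArg (relabel · _) (funext fun v => ?_)
  exact (congrFun (hardwiredInput_trans_equiv _ (finCongr (Nat.add_assoc _ _ _).symm) _) _).trans <|
    congrArg (fun x => x ∘ Fin.cast (Nat.add_assoc _ _ _)) (hardwiredInput_appendWires _ _ _ _ _)

end Reduction

/-! ### Computational hiding -/

section StrongSecurity

variable {ℓ c s : ℕ → ℕ}

/-- The law of the output of the circuit on a uniformly random input. -/
def seededPMF {m n : ℕ} (C : Circuit m n) : PMF (Bits n) :=
  (PMF.uniformOfFintype (Bits m)).bind C.outDist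

/-- No non-uniform QPT algorithm distinguishes the output of `G` on a uniform seed from a uniform
string. -/
def StrongSecurity (G : ∀ n, Circuit n (ℓ n)) : Prop :=
  ∀ A : NonuniformQPT ℓ fun _ => 1, Negligible fun n =>
    |A.accept n (classicalState (seededPMF (G n))) -
      A.accept n (classicalState (PMF.uniformOfFintype (Bits (ℓ n))))|

variable {G : ∀ n, Circuit n (ℓ n)}

/-- A non-uniform distinguisher has the best hardwired bits and advice built in for every security
parameter, so one negligible function bounds the advantage for all choices at once. -/
theorem StrongSecurity.exists_negligible_bound (hG : StrongSecurity G)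
    (D : NonuniformQPT (fun n => c n + s n) fun _ => 1) {ι : ℕ → Type*} [∀ n, Finite (ι n)]
    [∀ n, Nonempty (ι n)] (ρ : ∀ n, ι n → Op (s n)) (hρ : ∀ n i, IsDensity (ρ n i))
    (hle : ∀ n, ℓ n ≤ c n) :
    ∃ δ, Negligible δ ∧ ∀ n i (e : Fin (ℓ n) ↪ Fin (c n)) z,
      let f y := D.accept n (tensor (classicalState (PMF.pure (hardwiredInput e z y))) (ρ n i))
      |expectation (seededPMF (G n)) f - expectation (PMF.uniformOfFintype _) f| ≤ δ n := by
  let f n (p : (Fin (ℓ n) ↪ Fin (c n)) × Bits (c n) × ι n) (y : Bits (ℓ n)) : ℝ :=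
    D.accept n (tensor (classicalState (PMF.pure (hardwiredInput p.1 p.2.1 y))) (ρ n p.2.2))
  let advantage n p : ℝ :=
    |expectation (seededPMF (G n)) (f n p) - expectation (PMF.uniformOfFintype _) (f n p)|
  have hmax n : ∃ p, ∀ p', advantage n p' ≤ advantage n p := by
    have : Nonempty (Fin (ℓ n) ↪ Fin (c n)) :=
      Function.Embedding.nonempty_of_card_le (by simpa using hle n)
    exact Finite.exists_max (advantage n)
  choose p hp using hmax
  refine ⟨fun n => advantage n (p n), ?_, fun n i e z => hp n (e, z, i)⟩
  let A : NonuniformQPT ℓ fun _ => 1 := hardwireReduction D (fun n => (p n).1)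
    (fun n => (p n).2.1) (fun n => ρ n (p n).2.2) fun n => hρ n _
  have haccept n (μ : PMF (Bits (ℓ n))) :
      A.accept n (classicalState μ) = expectation μ (f n (p n)) := by
    rw [A.accept_classicalState]
    exact congrArg (expectation μ) (funext fun y => accept_hardwireReduction D _ _ _ _ n y)
  simpa only [haccept] using hG A

end StrongSecurity

section Blocks

variable {n m : ℕ}

/-- The positions of the `j`-th block of a concatenation. -/
def blockEmb (j : Fin n) : Fin m ↪ Fin (n * m) :=
  ⟨fun i => finProdFinEquiv (j, i), finProdFinEquiv.injective.comp (Prod.mk_right_injective j)⟩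

theorem concat_update_maskBits (b : Bool) (r : Bits m) (w : Fin n → Bits m) (j : Fin n)
    (y : Bits m) :
    concat (Function.update w j (maskBits b r y)) =
      hardwiredInput (blockEmb j)
        (concat (Function.update w j (maskBits b r fun _ => false))) y := by
  funext k
  obtain ⟨⟨j', i⟩, rfl⟩ := finProdFinEquiv.surjective k
  rcases eq_or_ne j' j with rfl | hj
  · have hext := (blockEmb (m := m) j').injective.extend_apply y (fun _ => false) i
    change _ = xor _ (Function.extend (blockEmb j') y _ (blockEmb j' i))
    rw [hext]
    cases b <;> simp [concat, maskBits, Bool.xor_comm]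
  · have hext : Function.extend (blockEmb j) y (fun _ => false) (finProdFinEquiv (j', i)) = false :=
      Function.extend_apply' _ _ _ fun ⟨i', hi'⟩ =>
        hj (congrArg Prod.fst (finProdFinEquiv.injective hi')).symm
    simp [hardwiredInput, hext, concat, hj]

end Blocks

section Hiding

variable (G : ∀ n, Circuit n (3 * n))

/-- The law of the committer's message in the commit phase. -/
def commitmentPMF (n : ℕ) (b : Bool) (r : Bits (3 * n)) : PMF (Bits (n * (3 * n))) :=
  (productPMF fun _ : Fin n => (seededPMF (G n)).map (maskBits b r)).map concat

theorem map_fst_dist_commit (n : ℕ) (b : Bool) (r : Bits (3 * n)) :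
    ((naorCommitment G).commit n b r).dist.map Prod.fst = commitmentPMF G n b r := by
  rw [(runsWithin_commit G n b r).dist_eq, ← productPMF_uniform, PMF.map_bind, commitmentPMF]
  simp only [PMF.map_comp, seededPMF, PMF.map_bind, ← productPMF_bind]
  rfl

variable {G}

theorem abs_expectation_commitmentPMF_sub_le {n : ℕ} {f : Bits (n * (3 * n)) → ℝ} {δ : ℝ}
    (hδ : ∀ (e : Fin (3 * n) ↪ Fin (n * (3 * n))) z,
      |expectation (seededPMF (G n)) (fun y => f (hardwiredInput e z y)) -
        expectation (PMF.uniformOfFintype _) fun y => f (hardwiredInput e z y)| ≤ δ)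
    (b : Bool) (r : Bits (3 * n)) :
    |expectation (commitmentPMF G n b r) f -
      expectation (productPMF fun _ : Fin n => PMF.uniformOfFintype (Bits (3 * n)))
        (f ∘ concat)| ≤ n * δ := by
  have huniform : PMF.uniformOfFintype (Bits (3 * n)) =
      (PMF.uniformOfFintype _).map (maskBits b r) :=
    (map_uniformOfFintype_equiv (maskBits_involutive b r).toPerm).symm
  rw [commitmentPMF, expectation_map]
  refine abs_expectation_productPMF_sub_le _ _ _ fun j w => ?_
  rw [huniform, expectation_map, expectation_map]
  simpa only [Function.comp_def, ← concat_update_maskBits] using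
    hδ (blockEmb j) (concat (Function.update w j (maskBits b r fun _ => false)))

theorem abs_expectation_commitmentPMF_false_sub_true_le {n : ℕ} {f : Bits (n * (3 * n)) → ℝ}
    {δ : ℝ}
    (hδ : ∀ (e : Fin (3 * n) ↪ Fin (n * (3 * n))) z,
      |expectation (seededPMF (G n)) (fun y => f (hardwiredInput e z y)) -
        expectation (PMF.uniformOfFintype _) fun y => f (hardwiredInput e z y)| ≤ δ)
    (r : Bits (3 * n)) :
    |expectation (commitmentPMF G n false r) f - expectation (commitmentPMF G n true r) f| ≤
      2 * (n * δ) := by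
  let ideal := expectation (productPMF fun _ : Fin n => PMF.uniformOfFintype (Bits (3 * n)))
    (f ∘ concat)
  have hideal (b : Bool) : |expectation (commitmentPMF G n b r) f - ideal| ≤ n * δ :=
    abs_expectation_commitmentPMF_sub_le hδ b r
  calc |expectation (commitmentPMF G n false r) f - expectation (commitmentPMF G n true r) f|
      ≤ |expectation (commitmentPMF G n false r) f - ideal| +
        |ideal - expectation (commitmentPMF G n true r) f| := abs_sub_le _ _ _
    _ ≤ n * δ + n * δ := add_le_add (hideal false) (abs_sub_comm _ ideal ▸ hideal true)
    _ = 2 * (n * δ) := (two_mul _).symm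

theorem accept_receiverState {s : ℕ → ℕ}
    (R : NonuniformQPT (fun _ => 0) fun n => (naorCommitment G).qLen n + s n)
    (D : NonuniformQPT (fun n => (naorCommitment G).cLen n + s n) fun _ => 1) (n : ℕ) (b : Bool)
    {w : Bits (3 * n) → ℝ} {ρ : Bits (3 * n) → Op (s n)}
    (hρ : ∀ r, CommitmentScheme.outcomePart (R.run n 1) r = w r • ρ r) :
    D.accept n ((naorCommitment G).receiverState R n b) = ∑ r, w r *
      expectation (commitmentPMF G n b r) fun c =>
        D.accept n (tensor (classicalState (PMF.pure c)) (ρ r)) := by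
  refine (map_sum (D.acceptLinear n) _ _).trans (Finset.sum_congr rfl fun r _ => ?_)
  rw [hρ, tensor_smul_right, map_smul, smul_eq_mul]
  refine congrArg (w r * ·) ((D.accept_tensor_classicalState n _ _).trans ?_)
  exact congrArg (expectation · _) (map_fst_dist_commit G n b r)

theorem computationallyHiding_naorCommitment (hG : StrongSecurity G) :
    (naorCommitment G).ComputationallyHiding := by
  intro s R D
  have hσ n : IsDensity (R.run n 1) := R.run_isDensity n isDensity_one
  have hpos n r := outcomePart_posSemidef (hσ n).1 r
  choose ρ hρ hpart using fun (n : ℕ) (r : Bits (3 * n)) => exists_isDensity_smul (hpos n r)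
  obtain ⟨δ, hδ, hbound⟩ := hG.exists_negligible_bound (c := fun n => n * (3 * n)) D ρ hρ
    fun n => n.eq_zero_or_pos.elim (by rintro rfl; rfl) (Nat.le_mul_of_pos_left _)
  have hgap n : |D.accept n ((naorCommitment G).receiverState R n false) -
      D.accept n ((naorCommitment G).receiverState R n true)| ≤ 2 * (n * δ n) := by
    rw [accept_receiverState R D n false (hpart n), accept_receiverState R D n true (hpart n),
      ← Finset.sum_sub_distrib]
    simp only [← mul_sub]
    refine abs_sum_mul_le (fun r _ => (Complex.le_def.mp (hpos n r).trace_nonneg).1)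
      (sum_trace_outcomePart (hσ n)) fun r _ => ?_
    exact abs_expectation_commitmentPMF_false_sub_true_le
      (f := fun y => D.accept n (tensor (classicalState (PMF.pure y)) (ρ n r))) (hbound n r) r
  refine (hδ.param_mul.const_mul 2).trans_abs_le fun n => ?_
  rw [abs_abs]
  exact (hgap n).trans (le_abs_self _)

end Hiding

theorem eventually_le_of_isBigO_rpow_neg {μ : ℕ → ℝ} {c δ : ℝ} (hc : 0 < c) (hδ : 0 < δ)
    (hμ : μ =O[atTop] fun n : ℕ => (n : ℝ) ^ (-c)) : ∀ᶠ n in atTop, μ n ≤ δ :=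
  (hμ.trans_tendsto <|
    (tendsto_rpow_neg_atTop hc).comp tendsto_natCast_atTop_atTop).eventually_le_const hδ

end QCommit

end

theorem mainTheorem7_general (G : ∀ n, QCommit.Circuit n (3 * n)) (hqpt : QCommit.IsQPT G)
    {μ : ℕ → ℝ} (hdet : QCommit.Pseudodeterministic G μ)
    (hμ : ∀ᶠ n in Filter.atTop, μ n ≤ 1 / 192) (hsec : QCommit.StrongSecurity G) :
    (QCommit.naorCommitment G).Efficient ∧
    (QCommit.naorCommitment G).Correct ∧
    (QCommit.naorCommitment G).ComputationallyHiding ∧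
    (QCommit.naorCommitment G).StatisticallyBinding :=
  ⟨QCommit.efficient_naorCommitment G hqpt, QCommit.correct_naorCommitment G hdet hμ,
    QCommit.computationallyHiding_naorCommitment hsec,
    QCommit.statisticallyBinding_naorCommitment G⟩

theorem mainTheorem7 (G : ∀ n, QCommit.Circuit n (3 * n))
    (hG : QCommit.IsStrongQPRG (fun n => 3 * n) G) :
    (QCommit.naorCommitment G).Efficient ∧
    (QCommit.naorCommitment G).Correct ∧
    (QCommit.naorCommitment G).ComputationallyHiding ∧
    (QCommit.naorCommitment G).StatisticallyBinding :=
  let ⟨_, hc, _, hO, hdet⟩ := hG.pseudodeterminism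
  mainTheorem7_general G hG.qpt hdet
    (QCommit.eventually_le_of_isBigO_rpow_neg hc (by norm_num) hO) hG.strong_security
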